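/- Let $\mathbf D:\mathbb R\to\{1,2\}$ be given by $\mathbf D(x)=1$ if $|x|\in[2^{(2n)^2},2^{(2n+1)^2})$ for some integer $n\ge 0$, and $\mathbf D(x)=2$ otherwise. For $T>0$, $b\in\mathbb R$, a bounded measurable $a:\mathbb R\to\mathbb R$ and $u^{in}\in L^2(\mathbb R)$, a (weak) solution of $$\partial_t u+b\,\partial_x u-\partial_x\big(a(x)\,\partial_x u\big)=0\ \text{ on }(0,T)\times\mathbb R,\qquad u(0,\cdot)=u^{in},$$ is a function $u\in L^2((0,T);H^1(\mathbb R))$ such that for all $\varphi\in C_c^\infty((-\infty,T)\times\mathbb R)$ $$\int_0^T\!\!\int_{\mathbb R}\big(-u\,\partial_t\varphi-b\,u\,\partial_x\varphi+a\,\partial_xu\,\partial_x\varphi\big)\,dx\,dt=\int_{\mathbb R}u^{in}(x)\,\varphi(0,x)\,dx .$$ **Proposition.** Let $T>0$. There are two sequences of positive numbers $\varepsilon_n\to0$ and $\varepsilon_n'\to0$ such that the following holds for every $u^{in}\in L^2(\mathbb R)$. For each $\varepsilon>0$ let $u^\varepsilon$ be a solution of $$\partial_t u^\varepsilon+\tfrac1\varepsilon\,\partial_x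 u^\varepsilon-\partial_x\big(\mathbf D(x)\,\partial_x u^\varepsilon\big)=0\ \text{ on }(0,T)\times\mathbb R,\qquad u^\varepsilon(0,\cdot)=u^{in},$$ and put $v^\varepsilon(t,X)=u^\varepsilon(t,X+t/\varepsilon)$. Then $v^{\varepsilon_n}\rightharpoonup u_0$ and $v^{\varepsilon_n'}\rightharpoonup u_0'$ weakly in $L^2((0,T)\times\mathbb R)$, where $u_0$ and $u_0'$ are solutions of two different heat equations with the same initial datum, $$\partial_t u_0-\partial_X^2u_0=0,\qquad \partial_t u_0'-2\,\partial_X^2u_0'=0,\qquad u_0(0,\cdot)=u_0'(0,\cdot)=u^{in};$$ in particular $u_0\ne u_0'$ as elements of $L^2((0,T)\times\mathbb R)$ unless $u^{in}=0$ almost everywhere. -/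

import Mathlib

open MeasureTheory Set Filter Topology
open scoped ContDiff

namespace LagrangianLimit

noncomputable section

/-- Lebesgue measure on the space-time strip `(0,T) × ℝ`; points are written `z = (t, x)`. -/
def stripMeasure (T : ℝ) : Measure (ℝ × ℝ) :=
  (volume.restrict (Ioo 0 T)).prod volume

/-- The partial derivative `∂φ/∂t` of a function of `(t, x)`. -/
def partialT (φ : ℝ × ℝ → ℝ) (z : ℝ × ℝ) : ℝ := fderiv ℝ φ z (1, 0)

/-- The partial derivative `∂φ/∂x` of a function of `(t, x)`. -/
def partialX (φ : ℝ × ℝ → ℝ) (z : ℝ × ℝ) : ℝ := fderiv ℝ φ z (0, 1)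

/-- `g` is the weak derivative `∂u/∂x` on `(0,T) × ℝ`: the test functions are the smooth functions
with compact support in the open strip. -/
def IsWeakPartialX (T : ℝ) (u g : ℝ × ℝ → ℝ) : Prop :=
  ∀ φ : ℝ × ℝ → ℝ, ContDiff ℝ ∞ φ → HasCompactSupport φ → tsupport φ ⊆ Ioo 0 T ×ˢ univ →
    ∫ z, u z * partialX φ z ∂stripMeasure T = -∫ z, g z * φ z ∂stripMeasure T

/-- `u` is a weak solution in `L²((0,T); H¹(ℝ))` of the Cauchy problem
`∂u/∂t + b ∂u/∂x - ∂/∂x (a(x) ∂u/∂x) = 0` on `(0,T) × ℝ`, `u(0, ·) = uin`, with a constant drift `b`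
and a bounded diffusion coefficient `a`. The test functions are smooth with compact support in
`(-∞,T) × ℝ`; they need not vanish at `t = 0`, and so carry the initial condition. -/
def IsWeakSolution (T b : ℝ) (a uin : ℝ → ℝ) (u : ℝ × ℝ → ℝ) : Prop :=
  MemLp u 2 (stripMeasure T) ∧
  ∃ g : ℝ × ℝ → ℝ, MemLp g 2 (stripMeasure T) ∧ IsWeakPartialX T u g ∧
    ∀ φ : ℝ × ℝ → ℝ, ContDiff ℝ ∞ φ → HasCompactSupport φ → tsupport φ ⊆ Iio T ×ˢ univ →
      ∫ z, (-(u z * partialT φ z) - b * (u z * partialX φ z) + a z.2 * g z * partialX φ z)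
          ∂stripMeasure T
        = ∫ x, uin x * φ (0, x)

open Classical in
/-- The diffusion coefficient: `1` if `|x| ∈ [2^{(2n)²}, 2^{(2n+1)²})` for some integer `n ≥ 0`, and
`2` otherwise. -/
def diffusionCoeff (x : ℝ) : ℝ :=
  if ∃ n : ℕ, |x| ∈ Ico ((2 : ℝ) ^ ((2 * n) ^ 2)) ((2 : ℝ) ^ ((2 * n + 1) ^ 2)) then 1 else 2

/-- A function `u(t, x)` read in the moving coordinate: `v(t, X) = u(t, X + t/ε)`. -/
def lagrangian (ε : ℝ) (u : ℝ × ℝ → ℝ) : ℝ × ℝ → ℝ :=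
  fun z => u (z.1, z.2 + z.1 / ε)

/-- Weak convergence `v n ⇀ w` in `L²((0,T) × ℝ)`. -/
def WeaklyConvergesL2 (T : ℝ) (v : ℕ → ℝ × ℝ → ℝ) (w : ℝ × ℝ → ℝ) : Prop :=
  (∀ n, MemLp (v n) 2 (stripMeasure T)) ∧ MemLp w 2 (stripMeasure T) ∧
    ∀ ψ : ℝ × ℝ → ℝ, MemLp ψ 2 (stripMeasure T) →
      Tendsto (fun n => ∫ z, v n z * ψ z ∂stripMeasure T) atTop
        (𝓝 (∫ z, w z * ψ z ∂stripMeasure T))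

end

end LagrangianLimit

/-! In the moving frame the drift disappears: `v(t, X) = u(t, X + t/ε)` solves `∂v/∂t = ∂/∂X (D(X +
t/ε) ∂v/∂X)`. The radii `2^(k²)` grow so fast that the ratio of the inner to the outer radius of an
annulus tends to `0`. If `ε` is `2T` divided by the outer radius of the `k`-th annulus, then for
fixed `t ∈ (0,T)` and `X` the point `X + t/ε` lies in that annulus for all large `k`
(`eventually_mem_annulus`). Even `k` therefore gives coefficients converging pointwise to `1`, and
odd `k` to `2`.

The passage to the limit (`exists_weak_limit_of_coefficients_tendsto`) uses energy bounds on `v` and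
`∂v/∂X`, weak compactness in `L²`, and strong convergence of the coefficient times a test function.
Uniqueness for the limiting heat equation (`IsWeakSolution.ae_eq`) identifies all weak limits, so
the whole sequence converges.

Bounds, uniqueness and distinctness of the limits all rest on the energy estimates
`IsWeakFluxSolution.energy` for `∂v/∂t = ∂F/∂x`. Mollifying in `x` alone turns this equation, for
almost every `x`, into an ODE in `t` with integrable right-hand side. The energy identities of the
ODE are integrated over `x`, and the mollification is removed by Fatou's lemma. -/

namespace LagrangianLimit

/-! ### Weak first-order equations in time. -/

/-- Every test function on `(0,T)` is the derivative, on `(0,T)`, of a test function on `(-∞,T)`. -/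
lemma exists_testFunction_deriv_eq {T : ℝ} (hT : 0 < T) {ψ : ℝ → ℝ} (hψ : ContDiff ℝ ∞ ψ)
    (hc : HasCompactSupport ψ) (hs : tsupport ψ ⊆ Ioo 0 T) :
    ∃ χ : ℝ → ℝ, ContDiff ℝ ∞ χ ∧ HasCompactSupport χ ∧ tsupport χ ⊆ Iio T ∧
      ∀ t ∈ Ioo 0 T, deriv χ t = ψ t := by
  obtain ⟨b, hbT, hb⟩ : ∃ b < T, ∀ t, b < t → ψ t = 0 := by
    rcases (tsupport ψ).eq_empty_or_nonempty with h | h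
    · exact ⟨0, hT, fun t _ => by
        rw [tsupport_eq_empty_iff] at h; simp [h]⟩
    · obtain ⟨b, hb⟩ := hc.isCompact.exists_isGreatest h
      refine ⟨b, (hs hb.1).2, fun t ht => ?_⟩
      by_contra h0
      exact absurd (hb.2 (subset_tsupport ψ h0)) (not_le.2 ht)
  -- Integrating from `T` makes the primitive vanish near `T` and beyond. To the left of the support
  -- of `ψ` it is a constant, in general nonzero, so a cutoff `θ` equal to `1` on `[-T, T]` restores
  -- compact support.
  set P : ℝ → ℝ := fun t => ∫ s in T..t, ψ s with hP
  have hPd : ∀ t, HasDerivAt P (ψ t) t := fun t =>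
    intervalIntegral.integral_hasDerivAt_right (hψ.continuous.intervalIntegrable _ _)
      (hψ.continuous.stronglyMeasurableAtFilter _ _) hψ.continuous.continuousAt
  have hPsm : ContDiff ℝ ∞ P := by
    rw [contDiff_infty_iff_deriv]
    exact ⟨fun t => (hPd t).differentiableAt, by
      rwa [show deriv P = ψ from funext fun t => (hPd t).deriv]⟩
  have hP0 : ∀ t, b < t → P t = 0 := by
    intro t ht
    simp only [hP]
    rw [intervalIntegral.integral_congr (g := fun _ => 0)]
    · simp
    · intro s hs
      refine hb s ?_
      have := hs.1
      exact lt_of_lt_of_le (lt_min hbT ht) this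
  let θ : ContDiffBump (0 : ℝ) := ⟨T, T + 1, hT, by linarith⟩
  refine ⟨fun t => θ t * P t, θ.contDiff.mul hPsm, θ.hasCompactSupport.mul_right, ?_, ?_⟩
  · have : tsupport (fun t => θ t * P t) ⊆ Iic b := by
      refine closure_minimal (fun t ht => ?_) isClosed_Iic
      by_contra h
      exact ht (by simp [hP0 t (not_le.1 h)])
    exact this.trans (Iic_subset_Iio.2 hbT)
  · intro t ht
    have : (fun t => θ t * P t) =ᶠ[𝓝 t] P := by
      filter_upwards [isOpen_Ioo.mem_nhds ht] with s hs
      rw [θ.one_of_mem_closedBall, one_mul]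
      rw [mem_closedBall_zero_iff, Real.norm_eq_abs, abs_of_pos hs.1]
      exact hs.2.le
    rw [this.deriv_eq, (hPd t).deriv]

/-- A weak solution of `p' = q`, `p(0) = c` on `(0,T)` is the primitive of `q`. -/
lemma ae_eq_primitive_of_weak {T c : ℝ} (hT : 0 < T) {p q : ℝ → ℝ}
    (hp : IntegrableOn p (Ioo 0 T)) (hq : IntegrableOn q (Ioo 0 T))
    (h : ∀ χ : ℝ → ℝ, ContDiff ℝ ∞ χ → HasCompactSupport χ → tsupport χ ⊆ Iio T →
      ∫ t in Ioo 0 T, (-(deriv χ t * p t) - χ t * q t) = c * χ 0) :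
    ∀ᵐ t ∂volume.restrict (Ioo 0 T), p t = c + ∫ s in (0 : ℝ)..t, q s := by
  have hqi : IntervalIntegrable q volume 0 T := by
    rwa [intervalIntegrable_iff_integrableOn_Ioo_of_le hT.le]
  have hAC := hqi.absolutelyContinuousOnInterval_intervalIntegral (c := 0) (by simp)
  set P : ℝ → ℝ := fun t => ∫ s in (0 : ℝ)..t, q s with hPdef
  have hPc : ContinuousOn P (Icc 0 T) := by
    have := hAC.continuousOn; rwa [uIcc_of_le hT.le] at this
  have hPi : IntegrableOn P (Ioo 0 T) :=
    (hPc.integrableOn_compact isCompact_Icc).mono_set Ioo_subset_Icc_self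
  have hPq : ∀ᵐ t ∂volume.restrict (Ioo 0 T), deriv P t = q t := by
    rw [ae_restrict_iff' measurableSet_Ioo]
    filter_upwards [hqi.ae_hasDerivAt_integral] with t ht htI
    rw [uIcc_of_le hT.le] at ht
    exact (ht (Ioo_subset_Icc_self htI) 0 ⟨le_rfl, hT.le⟩).deriv
  -- Testing `p - (c + P)` against `ψ = χ'` gives zero: the weak equation handles `p`, and
  -- integration by parts handles `P`, which is only absolutely continuous. The boundary terms
  -- vanish because `χ T = 0` and `P 0 = 0`.
  have key : ∀ᵐ t ∂volume, t ∈ Ioo 0 T → p t - (c + P t) = 0 := by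
    refine isOpen_Ioo.ae_eq_zero_of_integral_contDiff_smul_eq_zero
      (((hp.sub ((integrable_const c).add hPi))).locallyIntegrableOn) ?_
    intro ψ hψ hψc hψs
    obtain ⟨χ, hχ, hχc, hχs, hχψ⟩ := exists_testFunction_deriv_eq hT hψ hψc hψs
    have hχT : χ T = 0 := by
      by_contra h0; exact lt_irrefl T (hχs (subset_tsupport χ h0))
    have hχd : Continuous (deriv χ) := hχ.continuous_deriv (by simp)
    have hχAC : AbsolutelyContinuousOnInterval χ 0 T :=
      (hχ.of_le (by simp)).contDiffOn.absolutelyContinuousOnInterval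
    have hparts := hχAC.integral_deriv_mul_eq_sub hAC
    rw [intervalIntegral.integral_of_le hT.le, integral_Ioc_eq_integral_Ioo] at hparts
    have hbd : ∀ f : ℝ → ℝ, Continuous f → ∀ r : ℝ → ℝ, IntegrableOn r (Ioo 0 T) →
        IntegrableOn (fun t => f t * r t) (Ioo 0 T) := by
      intro f hf r hr
      obtain ⟨C, hC⟩ := (isCompact_Icc (a := (0:ℝ)) (b := T)).exists_bound_of_continuousOn
        hf.continuousOn
      refine Integrable.bdd_mul (c := C) hr hf.aestronglyMeasurable ?_
      exact (ae_restrict_iff' measurableSet_Ioo).2 (ae_of_all _ fun t ht =>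
        hC t (Ioo_subset_Icc_self ht))
    have i1 := hbd _ hχd p hp
    have i2 := hbd _ hχ.continuous q hq
    have i3 := hbd _ hχd P hPi
    have i4 := hbd _ hχd (fun _ => c) (integrable_const c)
    have e1 : ∫ t in Ioo 0 T, deriv χ t * P t + χ t * q t = 0 := by
      rw [← integral_congr_ae (f := fun t => deriv χ t * P t + χ t * deriv P t), hparts]
      · simp [hχT, hPdef]
      · filter_upwards [hPq] with t ht
        rw [ht]
    have e2 := h χ hχ hχc hχs
    have e3 : ∫ t in Ioo 0 T, deriv χ t * c = -(c * χ 0) := by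
      rw [integral_mul_const, ← integral_Ioc_eq_integral_Ioo,
        ← intervalIntegral.integral_of_le hT.le, intervalIntegral.integral_deriv_eq_sub
          (fun t _ => hχ.differentiable (by simp) t) (hχd.intervalIntegrable _ _), hχT]
      ring
    have e4 : ∫ t in Ioo 0 T, ψ t • (p t - (c + P t)) = 0 := by
      have : ∫ t in Ioo 0 T, ψ t • (p t - (c + P t)) = -(∫ t in Ioo 0 T,
          (-(deriv χ t * p t) - χ t * q t)) - (∫ t in Ioo 0 T, deriv χ t * c) -
          ∫ t in Ioo 0 T, deriv χ t * P t + χ t * q t := by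
        rw [← integral_neg, ← integral_sub, ← integral_sub]
        · refine setIntegral_congr_fun measurableSet_Ioo fun t ht => ?_
          simp only [smul_eq_mul, ← hχψ t ht]
          ring
        · exact ((i1.neg.sub i2).neg.sub i4)
        · exact i3.add i2
        · exact (i1.neg.sub i2).neg
        · exact i4
      rw [this, e1, e2, e3]; ring
    rw [← e4]
    refine (setIntegral_eq_integral_of_forall_compl_eq_zero fun t ht => ?_).symm
    have : ψ t = 0 := by
      by_contra h0; exact ht (hψs (subset_tsupport ψ h0))
    simp [this]
  rw [ae_restrict_iff' measurableSet_Ioo]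
  filter_upwards [key] with t ht hI
  linarith [ht hI]

/-- The two energy identities of `p' = q`, `p(0) = c`, on `(0,T)`. -/
lemma energy_of_ae_eq_primitive {T c : ℝ} (hT : 0 < T) {p q : ℝ → ℝ}
    (hq : IntegrableOn q (Ioo 0 T))
    (h : ∀ᵐ t ∂volume.restrict (Ioo 0 T), p t = c + ∫ s in (0 : ℝ)..t, q s) :
    0 ≤ c ^ 2 + 2 * ∫ t in Ioo 0 T, q t * p t ∧
    ∫ t in Ioo 0 T, p t ^ 2 = T * c ^ 2 + 2 * ∫ t in Ioo 0 T, (T - t) * (q t * p t) := by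
  have hqi : IntervalIntegrable q volume 0 T := by
    rwa [intervalIntegrable_iff_integrableOn_Ioo_of_le hT.le]
  have hAC0 := hqi.absolutelyContinuousOnInterval_intervalIntegral (c := 0) (by simp)
  have hcAC : ∀ f : ℝ → ℝ, ContDiff ℝ 1 f → AbsolutelyContinuousOnInterval f 0 T :=
    fun f hf => hf.contDiffOn.absolutelyContinuousOnInterval
  set P : ℝ → ℝ := fun t => c + ∫ s in (0 : ℝ)..t, q s with hPdef
  have hAC : AbsolutelyContinuousOnInterval P 0 T := (hcAC _ contDiff_const).add hAC0
  have hPq : ∀ᵐ t ∂volume.restrict (Ioo 0 T), HasDerivAt P (q t) t := by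
    rw [ae_restrict_iff' measurableSet_Ioo]
    filter_upwards [hqi.ae_hasDerivAt_integral] with t ht htI
    rw [uIcc_of_le hT.le] at ht
    exact (ht (Ioo_subset_Icc_self htI) 0 ⟨le_rfl, hT.le⟩).const_add c
  have hPc : ContinuousOn P (Icc 0 T) := by
    have := hAC.continuousOn; rwa [uIcc_of_le hT.le] at this
  have hP0 : P 0 = c := by simp [hPdef]
  -- `h1` integrates `(P²)'`; dropping `P(T)²` leaves an inequality. `h2` integrates `((T - t)
  -- P²)'`, where the weight removes the terminal value and its derivative produces `∫ P²`.
  have h1 := hAC.integral_deriv_mul_eq_sub hAC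
  have h2 := (((hcAC (fun t => T - t) (by fun_prop)).mul hAC)).integral_deriv_mul_eq_sub hAC
  rw [intervalIntegral.integral_of_le hT.le, integral_Ioc_eq_integral_Ioo] at h1 h2
  have e1 : ∫ t in Ioo 0 T, deriv P t * P t + P t * deriv P t
      = 2 * ∫ t in Ioo 0 T, q t * p t := by
    rw [← integral_const_mul]
    refine integral_congr_ae ?_
    filter_upwards [hPq, h] with t ht ht'
    rw [ht.deriv, ht']; ring
  have hPi : IntegrableOn (fun t => P t ^ 2) (Ioo 0 T) :=
    ((hPc.pow 2).integrableOn_compact isCompact_Icc).mono_set Ioo_subset_Icc_self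
  have hqP : IntegrableOn (fun t => (T - t) * (q t * P t)) (Ioo 0 T) := by
    have hc : ContinuousOn (fun t => (T - t) * P t) (Icc 0 T) := by fun_prop
    obtain ⟨C, hC⟩ := (isCompact_Icc (a := (0:ℝ)) (b := T)).exists_bound_of_continuousOn hc
    have : IntegrableOn (fun t => ((T - t) * P t) * q t) (Ioo 0 T) := by
      refine Integrable.bdd_mul (c := C) hq
        ((hc.mono Ioo_subset_Icc_self).aestronglyMeasurable measurableSet_Ioo) ?_
      exact (ae_restrict_iff' measurableSet_Ioo).2 (ae_of_all _ fun t ht =>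
        hC t (Ioo_subset_Icc_self ht))
    exact this.congr (ae_of_all _ fun t => by ring)
  have e2 : ∫ t in Ioo 0 T, deriv ((fun t => T - t) * P) t * P t
      + ((fun t => T - t) * P) t * deriv P t
      = -(∫ t in Ioo 0 T, p t ^ 2) + 2 * ∫ t in Ioo 0 T, (T - t) * (q t * p t) := by
    rw [integral_congr_ae (f := fun t => p t ^ 2) (g := fun t => P t ^ 2) (by
        filter_upwards [h] with t ht; rw [ht]),
      integral_congr_ae (f := fun t => (T - t) * (q t * p t)) (g := fun t => (T - t) * (q t * P t))
        (by filter_upwards [h] with t ht; rw [ht]), ← integral_const_mul, ← integral_neg]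
    refine Eq.trans ?_ (integral_add hPi.neg (hqP.const_mul 2))
    refine integral_congr_ae ?_
    filter_upwards [hPq] with t ht
    have hd : HasDerivAt ((fun t => T - t) * P) ((-1) * P t + (T - t) * q t) t :=
      ((hasDerivAt_id t).const_sub T).mul ht
    rw [hd.deriv, ht.deriv]
    simp only [Pi.mul_apply]
    ring
  rw [e1, hP0] at h1
  rw [e2] at h2
  simp only [Pi.mul_apply, hP0] at h2
  constructor
  · nlinarith [sq_nonneg (P T)]
  · linarith

end LagrangianLimit

/-! ### Mollification in space: Young's inequality and pointwise convergence. -/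

namespace LagrangianLimit

open scoped ENNReal

/-- Convolution in the space variable, `(t, x) ↦ ∫ f(t, y) k(x - y) dy`. -/
noncomputable def mollX (k : ℝ → ℝ) (f : ℝ × ℝ → ℝ) (z : ℝ × ℝ) : ℝ :=
  ∫ y, f (z.1, y) * k (z.2 - y)

/-- Cauchy–Schwarz after writing `f k` as `(f √k) · √k`. -/
lemma sq_lintegral_mul_le {α : Type*} [MeasurableSpace α] {μ : Measure α} {f k : α → ℝ≥0∞}
    (hf : AEMeasurable f μ) (hk : AEMeasurable k μ) :
    (∫⁻ y, f y * k y ∂μ) ^ 2 ≤ (∫⁻ y, k y ∂μ) * ∫⁻ y, f y ^ 2 * k y ∂μ := by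
  have h := ENNReal.lintegral_mul_le_Lp_mul_Lq μ (p := 2) (q := 2)
    (Real.holderConjugate_iff.2 ⟨by norm_num, by norm_num⟩)
    (f := fun y => f y * k y ^ (1 / 2 : ℝ)) (g := fun y => k y ^ (1 / 2 : ℝ))
    (hf.mul (hk.pow_const _)) (hk.pow_const _)
  have hh : ∀ a : ℝ≥0∞, a ^ (1 / 2 : ℝ) * a ^ (1 / 2 : ℝ) = a := fun a => by
    rw [← ENNReal.rpow_add_of_nonneg _ _ (by norm_num) (by norm_num)]; norm_num
  have hsq : ∀ a : ℝ≥0∞, (a ^ (1 / 2 : ℝ)) ^ 2 = a := fun a => by rw [sq, hh]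
  have e1 : ∀ y, ((fun y => f y * k y ^ (1 / 2 : ℝ)) * fun y => k y ^ (1 / 2 : ℝ)) y
      = f y * k y := fun y => by simp only [Pi.mul_apply, mul_assoc, hh]
  simp only [e1, ENNReal.rpow_two, mul_pow, hsq] at h
  calc _ ≤ _ := pow_le_pow_left' h 2
    _ = _ := by rw [mul_pow, hsq, hsq, mul_comm]

/-- Young's inequality `‖f * k‖₂ ≤ ‖f‖₂ ‖k‖₁` on the line. -/
lemma lintegral_convolution_sq_le {f k : ℝ → ℝ} (hf : Measurable f) (hk : Measurable k) :
    ∫⁻ x, ‖∫ y, f y * k (x - y)‖ₑ ^ 2 ≤ (∫⁻ y, ‖k y‖ₑ) ^ 2 * ∫⁻ y, ‖f y‖ₑ ^ 2 := by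
  have hm : ∀ x, Measurable fun y => ‖k (x - y)‖ₑ := fun x =>
    (hk.comp (measurable_const.sub measurable_id)).enorm
  calc ∫⁻ x, ‖∫ y, f y * k (x - y)‖ₑ ^ 2
      ≤ ∫⁻ x, (∫⁻ y, ‖k y‖ₑ) * ∫⁻ y, ‖f y‖ₑ ^ 2 * ‖k (x - y)‖ₑ := by
        refine lintegral_mono fun x => ?_
        have h1 : ‖∫ y, f y * k (x - y)‖ₑ ≤ ∫⁻ y, ‖f y‖ₑ * ‖k (x - y)‖ₑ := by
          refine (enorm_integral_le_lintegral_enorm _).trans_eq ?_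
          simp only [enorm_mul]
        refine (pow_le_pow_left' h1 2).trans ?_
        refine (sq_lintegral_mul_le hf.enorm.aemeasurable (hm x).aemeasurable).trans_eq ?_
        rw [lintegral_sub_left_eq_self (fun y => ‖k y‖ₑ) x]
    _ = (∫⁻ y, ‖k y‖ₑ) * ∫⁻ x, ∫⁻ y, ‖f y‖ₑ ^ 2 * ‖k (x - y)‖ₑ := by
        rw [lintegral_const_mul]
        exact Measurable.lintegral_prod_right' (f := fun z : ℝ × ℝ => ‖f z.2‖ₑ ^ 2 * ‖k (z.1 - z.2)‖ₑ)
          (((hf.comp measurable_snd).enorm.pow_const 2).mul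
            (hk.comp (measurable_fst.sub measurable_snd)).enorm)
    _ = _ := by
        rw [lintegral_lintegral_swap]
        · have : ∀ y, ∫⁻ x, ‖f y‖ₑ ^ 2 * ‖k (x - y)‖ₑ = ‖f y‖ₑ ^ 2 * ∫⁻ x, ‖k x‖ₑ := by
            intro y
            rw [lintegral_const_mul _ (f := fun x => ‖k (x - y)‖ₑ) (by fun_prop),
              lintegral_sub_right_eq_self (fun y => ‖k y‖ₑ) y]
          simp only [this]
          rw [lintegral_mul_const _ (hf.enorm.pow_const 2)]
          ring
        · exact (((hf.comp measurable_snd).enorm.pow_const 2).mul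
            (hk.comp (measurable_fst.sub measurable_snd)).enorm).aemeasurable

variable {T : ℝ}

instance : SFinite (stripMeasure T) := by unfold stripMeasure; infer_instance

lemma measurable_mollX {k : ℝ → ℝ} {f : ℝ × ℝ → ℝ} (hk : Measurable k) (hf : Measurable f) :
    Measurable (mollX k f) := by
  refine StronglyMeasurable.measurable ?_
  refine StronglyMeasurable.integral_prod_right'
    (f := fun w : (ℝ × ℝ) × ℝ => f (w.1.1, w.2) * k (w.1.2 - w.2)) ?_
  exact Measurable.stronglyMeasurable (by fun_prop)

lemma lintegral_mollX_sq_le {k : ℝ → ℝ} {f : ℝ × ℝ → ℝ} (hk : Measurable k) (hf : Measurable f) :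
    ∫⁻ z, ‖mollX k f z‖ₑ ^ 2 ∂stripMeasure T
      ≤ (∫⁻ y, ‖k y‖ₑ) ^ 2 * ∫⁻ z, ‖f z‖ₑ ^ 2 ∂stripMeasure T := by
  unfold stripMeasure
  rw [lintegral_prod _ ((measurable_mollX hk hf).enorm.pow_const 2).aemeasurable,
    lintegral_prod _ (hf.enorm.pow_const 2).aemeasurable, ← lintegral_const_mul]
  · exact lintegral_mono fun t => lintegral_convolution_sq_le (f := fun y => f (t, y))
      (hf.comp (by fun_prop)) hk
  · exact Measurable.lintegral_prod_right' (f := fun z : ℝ × ℝ => ‖f z‖ₑ ^ 2) (hf.enorm.pow_const 2)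

lemma memLp_two_iff_lintegral {α : Type*} [MeasurableSpace α] {μ : Measure α} {f : α → ℝ}
    (hf : AEStronglyMeasurable f μ) : MemLp f 2 μ ↔ ∫⁻ z, ‖f z‖ₑ ^ 2 ∂μ < ⊤ := by
  rw [memLp_two_iff_integrable_sq hf, Integrable, and_iff_right (show AEStronglyMeasurable (fun x => f x ^ 2) μ from hf.pow 2), HasFiniteIntegral]
  simp only [enorm_pow]

lemma memLp_mollX {k : ℝ → ℝ} {f : ℝ × ℝ → ℝ} (hk : Continuous k) (hkc : HasCompactSupport k)
    (hf : Measurable f) (hf2 : MemLp f 2 (stripMeasure T)) :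
    MemLp (mollX k f) 2 (stripMeasure T) := by
  rw [memLp_two_iff_lintegral (measurable_mollX hk.measurable hf).aestronglyMeasurable]
  refine (lintegral_mollX_sq_le hk.measurable hf).trans_lt (ENNReal.mul_lt_top ?_ ?_)
  · exact ENNReal.pow_lt_top (hk.integrable_of_hasCompactSupport hkc).2
  · exact (memLp_two_iff_lintegral hf2.1).1 hf2

lemma ae_memLp_slice {f : ℝ × ℝ → ℝ} (hf : Measurable f) (hf2 : MemLp f 2 (stripMeasure T)) :
    ∀ᵐ t ∂volume.restrict (Ioo 0 T), MemLp (fun y => f (t, y)) 2 volume := by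
  have := (memLp_two_iff_integrable_sq hf2.1).1 hf2
  filter_upwards [this.prod_right_ae] with t ht
  exact (memLp_two_iff_integrable_sq (hf.comp measurable_prodMk_left).aestronglyMeasurable).2 ht

lemma ae_memLp_slice_left {f : ℝ × ℝ → ℝ} (hf : Measurable f)
    (hf2 : MemLp f 2 (stripMeasure T)) :
    ∀ᵐ x ∂volume, MemLp (fun t => f (t, x)) 2 (volume.restrict (Ioo 0 T)) := by
  have := (memLp_two_iff_integrable_sq hf2.1).1 hf2
  filter_upwards [this.prod_left_ae] with t ht
  exact (memLp_two_iff_integrable_sq (hf.comp measurable_prodMk_right).aestronglyMeasurable).2 ht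

lemma mollX_eq_convolution (k : ℝ → ℝ) (f : ℝ × ℝ → ℝ) (t : ℝ) :
    (fun x => mollX k f (t, x))
      = convolution (fun y => f (t, y)) k (ContinuousLinearMap.mul ℝ ℝ) volume := rfl

lemma hasDerivAt_mollX {k : ℝ → ℝ} (hk : ContDiff ℝ ∞ k) (hkc : HasCompactSupport k)
    {f : ℝ × ℝ → ℝ} {t : ℝ} (hf : MemLp (fun y => f (t, y)) 2 volume) (x : ℝ) :
    HasDerivAt (fun x => mollX k f (t, x)) (mollX (deriv k) f (t, x)) x := by
  rw [mollX_eq_convolution]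
  exact hkc.hasDerivAt_convolution_right (ContinuousLinearMap.mul ℝ ℝ)
    (hf.locallyIntegrable (by norm_num)) (hk.of_le (by simp)) x

/-- Lebesgue differentiation on almost every time slice, then Fubini, for which the convergence set
must be measurable. The bound on the ratio of the radii is the regularity condition needed for
almost everywhere convergence. -/
lemma ae_tendsto_mollX {ρ : ℕ → ContDiffBump (0 : ℝ)}
    (hρ : Tendsto (fun n => (ρ n).rOut) atTop (𝓝 0)) (hρK : ∀ n, (ρ n).rOut ≤ 2 * (ρ n).rIn)
    {f : ℝ × ℝ → ℝ} (hf : Measurable f) (hf2 : MemLp f 2 (stripMeasure T)) :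
    ∀ᵐ z ∂stripMeasure T,
      Tendsto (fun n => mollX ((ρ n).normed volume) f z) atTop (𝓝 (f z)) := by
  have hm : MeasurableSet {z | Tendsto (fun n => mollX ((ρ n).normed volume) f z) atTop
      (𝓝 (f z))} :=
    measurableSet_tendsto_fun (fun n => measurable_mollX (ρ n).continuous_normed.measurable hf) hf
  unfold stripMeasure
  rw [Measure.ae_prod_iff_ae_ae hm]
  filter_upwards [ae_memLp_slice hf hf2] with t ht
  filter_upwards [ContDiffBump.ae_convolution_tendsto_right_of_locallyIntegrable hρ
    (Eventually.of_forall hρK) (ht.locallyIntegrable (by norm_num))] with x hx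
  refine hx.congr fun n => ?_
  rw [convolution_lsmul_swap]
  simp only [mollX, smul_eq_mul, mul_comm]

lemma lintegral_enorm_normed (ρ : ContDiffBump (0 : ℝ)) : ∫⁻ y, ‖ρ.normed volume y‖ₑ = 1 := by
  have h := ofReal_integral_norm_eq_lintegral_enorm (ρ.integrable_normed (μ := volume))
  rw [← h]
  simp only [Real.norm_eq_abs, abs_of_nonneg (ρ.nonneg_normed _), ρ.integral_normed,
    ENNReal.ofReal_one]

lemma exists_bumps : ∃ ρ : ℕ → ContDiffBump (0 : ℝ),
    Tendsto (fun n => (ρ n).rOut) atTop (𝓝 0) ∧ ∀ n, (ρ n).rOut ≤ 2 * (ρ n).rIn := by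
  refine ⟨fun n => ⟨1 / (n + 1) / 2, 1 / (n + 1), by positivity, half_lt_self (by positivity)⟩,
    tendsto_one_div_add_atTop_nhds_zero_nat, fun n => ?_⟩
  dsimp only
  linarith

end LagrangianLimit

/-! ### Product test functions and integration by parts in space. -/

namespace LagrangianLimit

variable {T : ℝ}

instance : IsFiniteMeasureOnCompacts (stripMeasure T) := by
  unfold stripMeasure; infer_instance

lemma integral_mollX_sq_le (ρ : ContDiffBump (0 : ℝ)) {f : ℝ × ℝ → ℝ} (hf : Measurable f)
    (hf2 : MemLp f 2 (stripMeasure T)) :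
    ∫ z, mollX (ρ.normed volume) f z ^ 2 ∂stripMeasure T ≤ ∫ z, f z ^ 2 ∂stripMeasure T := by
  have h := lintegral_mollX_sq_le (T := T) (ρ.continuous_normed (μ := volume)).measurable hf
  rw [lintegral_enorm_normed, one_pow, one_mul] at h
  rw [integral_eq_lintegral_of_nonneg_ae (ae_of_all _ fun z => sq_nonneg _)
      ((measurable_mollX ρ.continuous_normed.measurable hf).pow_const 2).aestronglyMeasurable,
    integral_eq_lintegral_of_nonneg_ae (ae_of_all _ fun z => sq_nonneg _) (hf2.1.pow 2)]
  have e : ∀ a : ℝ, ENNReal.ofReal (a ^ 2) = ‖a‖ₑ ^ 2 := fun a => by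
    rw [← enorm_pow, Real.enorm_of_nonneg (sq_nonneg a)]
  simp only [e]
  exact ENNReal.toReal_mono ((memLp_two_iff_lintegral hf2.1).1 hf2).ne h

lemma memLp_convolution {f k : ℝ → ℝ} (hf : Measurable f) (hf2 : MemLp f 2 volume)
    (hk : Continuous k) (hkc : HasCompactSupport k) :
    MemLp (fun x => ∫ y, f y * k (x - y)) 2 volume := by
  have hm : StronglyMeasurable fun x => ∫ y, f y * k (x - y) :=
    StronglyMeasurable.integral_prod_right' (f := fun w : ℝ × ℝ => f w.2 * k (w.1 - w.2))
      (Measurable.stronglyMeasurable (by fun_prop))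
  rw [memLp_two_iff_lintegral hm.aestronglyMeasurable]
  refine (lintegral_convolution_sq_le hf hk.measurable).trans_lt (ENNReal.mul_lt_top ?_ ?_)
  · exact ENNReal.pow_lt_top (hk.integrable_of_hasCompactSupport hkc).2
  · exact (memLp_two_iff_lintegral hf2.1).1 hf2

lemma integral_convolution_normed_sq_le (ρ : ContDiffBump (0 : ℝ)) {f : ℝ → ℝ} (hf : Measurable f)
    (hf2 : MemLp f 2 volume) :
    ∫ x, (∫ y, f y * ρ.normed volume (x - y)) ^ 2 ≤ ∫ y, f y ^ 2 := by
  have h := lintegral_convolution_sq_le hf (ρ.continuous_normed (μ := volume)).measurable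
  have hm := memLp_convolution hf hf2 (ρ.continuous_normed (μ := volume)) ρ.hasCompactSupport_normed
  rw [lintegral_enorm_normed, one_pow, one_mul] at h
  rw [integral_eq_lintegral_of_nonneg_ae (ae_of_all _ fun z => sq_nonneg _) (hm.1.pow 2),
    integral_eq_lintegral_of_nonneg_ae (ae_of_all _ fun z => sq_nonneg _) (hf2.1.pow 2)]
  have e : ∀ a : ℝ, ENNReal.ofReal (a ^ 2) = ‖a‖ₑ ^ 2 := fun a => by
    rw [← enorm_pow, Real.enorm_of_nonneg (sq_nonneg a)]
  simp only [e]
  exact ENNReal.toReal_mono ((memLp_two_iff_lintegral hf2.1).1 hf2).ne h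

section ProductTest

variable {χ k : ℝ → ℝ}

lemma partialT_mul_comp (hχ : ContDiff ℝ ∞ χ) (hk : ContDiff ℝ ∞ k) (x : ℝ) (z : ℝ × ℝ) :
    partialT (fun z => χ z.1 * k (x - z.2)) z = deriv χ z.1 * k (x - z.2) := by
  have h1 : HasFDerivAt (fun z : ℝ × ℝ => χ z.1) (deriv χ z.1 • ContinuousLinearMap.fst ℝ ℝ ℝ) z :=
    ((hχ.differentiable (by simp) z.1).hasDerivAt).comp_hasFDerivAt z hasFDerivAt_fst
  have h2 : HasFDerivAt (fun z : ℝ × ℝ => k (x - z.2))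
      (deriv k (x - z.2) • -ContinuousLinearMap.snd ℝ ℝ ℝ) z :=
    ((hk.differentiable (by simp) (x - z.2)).hasDerivAt).comp_hasFDerivAt z
      (hasFDerivAt_snd.const_sub x)
  rw [partialT, HasFDerivAt.fderiv (f := fun z : ℝ × ℝ => χ z.1 * k (x - z.2)) (h1.mul h2)]
  simp [mul_comm]

lemma partialX_mul_comp (hχ : ContDiff ℝ ∞ χ) (hk : ContDiff ℝ ∞ k) (x : ℝ) (z : ℝ × ℝ) :
    partialX (fun z => χ z.1 * k (x - z.2)) z = -(χ z.1 * deriv k (x - z.2)) := by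
  have h1 : HasFDerivAt (fun z : ℝ × ℝ => χ z.1) (deriv χ z.1 • ContinuousLinearMap.fst ℝ ℝ ℝ) z :=
    ((hχ.differentiable (by simp) z.1).hasDerivAt).comp_hasFDerivAt z hasFDerivAt_fst
  have h2 : HasFDerivAt (fun z : ℝ × ℝ => k (x - z.2))
      (deriv k (x - z.2) • -ContinuousLinearMap.snd ℝ ℝ ℝ) z :=
    ((hk.differentiable (by simp) (x - z.2)).hasDerivAt).comp_hasFDerivAt z
      (hasFDerivAt_snd.const_sub x)
  rw [partialX, HasFDerivAt.fderiv (f := fun z : ℝ × ℝ => χ z.1 * k (x - z.2)) (h1.mul h2)]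
  simp

lemma hasCompactSupport_mul_comp (hχ : HasCompactSupport χ) (hk : HasCompactSupport k) (x : ℝ) :
    HasCompactSupport fun z : ℝ × ℝ => χ z.1 * k (x - z.2) := by
  refine HasCompactSupport.intro (hχ.isCompact.prod
    (hk.isCompact.image (continuous_const.sub continuous_id : Continuous fun y : ℝ => x - y)))
    fun z hz => ?_
  by_contra h0
  refine hz ⟨subset_tsupport _ (left_ne_zero_of_mul h0),
    x - z.2, subset_tsupport _ (right_ne_zero_of_mul h0), by simp⟩

lemma tsupport_mul_comp_subset (x : ℝ) :
    tsupport (fun z : ℝ × ℝ => χ z.1 * k (x - z.2)) ⊆ tsupport χ ×ˢ univ :=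
  closure_minimal (fun _ hz => ⟨subset_tsupport _ (left_ne_zero_of_mul hz), trivial⟩)
    ((isClosed_tsupport χ).prod isClosed_univ)

/-- Testing against a product `χ(t) k(x - y)` amounts to testing the convolution against `χ`. -/
lemma integral_mul_product_eq (hχ : Continuous χ) (hχc : HasCompactSupport χ)
    (hk : Continuous k) (hkc : HasCompactSupport k) {f : ℝ × ℝ → ℝ}
    (hf : MemLp f 2 (stripMeasure T)) (x : ℝ) :
    Integrable (fun z => f z * (χ z.1 * k (x - z.2))) (stripMeasure T) ∧
    ∫ z, f z * (χ z.1 * k (x - z.2)) ∂stripMeasure T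
      = ∫ t in Ioo 0 T, χ t * mollX k f (t, x) := by
  have hφ : MemLp (fun z : ℝ × ℝ => χ z.1 * k (x - z.2)) 2 (stripMeasure T) :=
    Continuous.memLp_of_hasCompactSupport (by fun_prop) (hasCompactSupport_mul_comp hχc hkc x)
  have hi : Integrable (fun z => f z * (χ z.1 * k (x - z.2))) (stripMeasure T) :=
    hf.integrable_mul hφ
  refine ⟨hi, ?_⟩
  unfold stripMeasure at hi ⊢
  rw [integral_prod _ hi]
  refine integral_congr_ae (ae_of_all _ fun t => ?_)
  simp only [mollX]
  rw [← integral_const_mul]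
  exact integral_congr_ae (ae_of_all _ fun y => by ring)

end ProductTest

/-- Mollification turns the weak derivative into a classical one. -/
lemma mollX_deriv_ae_eq {v g : ℝ × ℝ → ℝ} (hv : Measurable v)
    (hg : Measurable g) (hv2 : MemLp v 2 (stripMeasure T)) (hg2 : MemLp g 2 (stripMeasure T))
    (hw : IsWeakPartialX T v g) {k : ℝ → ℝ} (hk : ContDiff ℝ ∞ k) (hkc : HasCompactSupport k) :
    mollX (deriv k) v =ᵐ[stripMeasure T] mollX k g := by
  have hkd : Continuous (deriv k) := hk.continuous_deriv (by simp)
  have m1 := memLp_mollX hkd hkc.deriv hv hv2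
  have m2 := memLp_mollX hk.continuous hkc hg hg2
  have n1 := measurable_mollX hkd.measurable hv
  have n2 := measurable_mollX hk.continuous.measurable hg
  -- For fixed `x`, the test functions `χ(t) k(x - y)` turn the weak derivative into an identity
  -- against every `χ`. The exceptional set of times depends on `x`; measurability and Fubini turn
  -- this into a null set of the strip.
  have hae : ∀ᵐ x ∂volume, ∀ᵐ t ∂volume.restrict (Ioo 0 T),
      mollX (deriv k) v (t, x) = mollX k g (t, x) := by
    filter_upwards [ae_memLp_slice_left n1 m1, ae_memLp_slice_left n2 m2] with x h1 h2
    have i1 : IntegrableOn (fun t => mollX (deriv k) v (t, x)) (Ioo 0 T) :=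
      h1.integrable (by norm_num)
    have i2 : IntegrableOn (fun t => mollX k g (t, x)) (Ioo 0 T) := h2.integrable (by norm_num)
    rw [ae_restrict_iff' measurableSet_Ioo]
    have := isOpen_Ioo.ae_eq_zero_of_integral_contDiff_smul_eq_zero (U := Ioo 0 T) (μ := volume)
      (f := fun t => mollX (deriv k) v (t, x) - mollX k g (t, x))
      (i1.sub i2).locallyIntegrableOn ?_
    · filter_upwards [this] with t ht hI
      exact sub_eq_zero.1 (ht hI)
    intro χ hχ hχc hχs
    have hz := hw (fun z => χ z.1 * k (x - z.2)) (by fun_prop) (hasCompactSupport_mul_comp hχc hkc x)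
      ((tsupport_mul_comp_subset x).trans (prod_mono hχs le_rfl))
    simp only [partialX_mul_comp hχ hk, mul_neg, integral_neg, neg_inj] at hz
    rw [(integral_mul_product_eq hχ.continuous hχc hkd hkc.deriv hv2 x).2,
      (integral_mul_product_eq hχ.continuous hχc hk.continuous hkc hg2 x).2] at hz
    have hb : ∀ r : ℝ → ℝ, IntegrableOn r (Ioo 0 T) →
        IntegrableOn (fun t => χ t * r t) (Ioo 0 T) := fun r hr => by
      obtain ⟨C, hC⟩ := hχc.exists_bound_of_continuous hχ.continuous
      exact Integrable.bdd_mul (c := C) hr hχ.continuous.aestronglyMeasurable (ae_of_all _ hC)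
    have e : ∫ t in Ioo 0 T, χ t • (mollX (deriv k) v (t, x) - mollX k g (t, x)) = 0 := by
      simp only [smul_eq_mul, mul_sub]
      rw [integral_sub (hb _ i1) (hb _ i2), hz, sub_self]
    rw [← e]
    refine (setIntegral_eq_integral_of_forall_compl_eq_zero fun t ht => ?_).symm
    have : χ t = 0 := by
      by_contra h0; exact ht (hχs (subset_tsupport χ h0))
    simp [this]
  have hms : MeasurableSet {z : ℝ × ℝ | mollX (deriv k) v z = mollX k g z} :=
    measurableSet_eq_fun n1 n2
  have := (Measure.ae_prod_iff_ae_ae (μ := volume.restrict (Ioo 0 T)) (ν := volume) hms).2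
    ((Measure.ae_ae_comm (p := fun x t => mollX (deriv k) v (t, x) = mollX k g (t, x))
      (measurable_swap hms)).1 hae)
  exact this

/-- Integration by parts in space for mollified functions. -/
lemma integral_mollX_deriv_mul {v g F : ℝ × ℝ → ℝ} (hv : Measurable v)
    (hg : Measurable g) (hF : Measurable F) (hv2 : MemLp v 2 (stripMeasure T))
    (hg2 : MemLp g 2 (stripMeasure T)) (hF2 : MemLp F 2 (stripMeasure T))
    (hw : IsWeakPartialX T v g) {k : ℝ → ℝ} (hk : ContDiff ℝ ∞ k) (hkc : HasCompactSupport k) :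
    ∫ z, mollX (deriv k) F z * mollX k v z ∂stripMeasure T
      = -∫ z, mollX k F z * mollX k g z ∂stripMeasure T := by
  have hkd : Continuous (deriv k) := hk.continuous_deriv (by simp)
  rw [← integral_congr_ae (f := fun z => mollX k F z * mollX (deriv k) v z)
    (g := fun z => mollX k F z * mollX k g z) (by
    filter_upwards [mollX_deriv_ae_eq hv hg hv2 hg2 hw hk hkc] with z hz; rw [hz])]
  have i1 : Integrable (fun z => mollX (deriv k) F z * mollX k v z) (stripMeasure T) :=
    (memLp_mollX hkd hkc.deriv hF hF2).integrable_mul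
    (memLp_mollX hk.continuous hkc hv hv2)
  have i2 : Integrable (fun z => mollX k F z * mollX (deriv k) v z) (stripMeasure T) :=
    (memLp_mollX hk.continuous hkc hF hF2).integrable_mul
    (memLp_mollX hkd hkc.deriv hv hv2)
  have i3 : Integrable (fun z => mollX k F z * mollX k v z) (stripMeasure T) :=
    (memLp_mollX hk.continuous hkc hF hF2).integrable_mul
    (memLp_mollX hk.continuous hkc hv hv2)
  unfold stripMeasure at i1 i2 i3 ⊢
  rw [integral_prod _ i1, integral_prod _ i2, ← integral_neg]
  refine integral_congr_ae ?_
  filter_upwards [i1.prod_right_ae, i2.prod_right_ae, i3.prod_right_ae, ae_memLp_slice hv hv2,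
    ae_memLp_slice hF hF2] with t h1 h2 h3 hvt hFt
  rw [integral_mul_deriv_eq_deriv_mul_of_integrable
    (u := fun x => mollX k F (t, x)) (u' := fun x => mollX (deriv k) F (t, x))
    (v := fun x => mollX k v (t, x)) (v' := fun x => mollX (deriv k) v (t, x))
    (fun x _ => hasDerivAt_mollX hk hkc hFt x) (fun x _ => hasDerivAt_mollX hk hkc hvt x) h2 h1 h3,
    neg_neg]

end LagrangianLimit

/-! ### Energy estimates for `∂v/∂t = ∂F/∂x`. -/

namespace LagrangianLimit

variable {T : ℝ}

/-- `v` is a weak solution of `∂v/∂t = ∂F/∂x` on the strip with initial datum `uin`. -/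
def IsWeakFluxSolution (T : ℝ) (uin : ℝ → ℝ) (v F : ℝ × ℝ → ℝ) : Prop :=
  ∀ φ : ℝ × ℝ → ℝ, ContDiff ℝ ∞ φ → HasCompactSupport φ → tsupport φ ⊆ Iio T ×ˢ univ →
    ∫ z, (-(v z * partialT φ z) + F z * partialX φ z) ∂stripMeasure T = ∫ x, uin x * φ (0, x)

lemma IsWeakPartialX.congr {v v' g g' : ℝ × ℝ → ℝ} (h : IsWeakPartialX T v g)
    (hv : v =ᵐ[stripMeasure T] v') (hg : g =ᵐ[stripMeasure T] g') : IsWeakPartialX T v' g' := by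
  intro φ h1 h2 h3
  rw [← integral_congr_ae (f := fun z => v z * partialX φ z)
      (by filter_upwards [hv] with z hz; rw [hz]), h φ h1 h2 h3,
    integral_congr_ae (g := fun z => g' z * φ z) (by filter_upwards [hg] with z hz; rw [hz])]

lemma IsWeakFluxSolution.congr {uin uin' : ℝ → ℝ} {v v' F F' : ℝ × ℝ → ℝ}
    (h : IsWeakFluxSolution T uin v F) (hu : uin =ᵐ[volume] uin')
    (hv : v =ᵐ[stripMeasure T] v') (hF : F =ᵐ[stripMeasure T] F') :
    IsWeakFluxSolution T uin' v' F' := by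
  intro φ h1 h2 h3
  rw [← integral_congr_ae (f := fun z => (-(v z * partialT φ z) + F z * partialX φ z))
      (by filter_upwards [hv, hF] with z hz hz'; rw [hz, hz']), h φ h1 h2 h3,
    integral_congr_ae (g := fun x => uin' x * φ (0, x))
      (by filter_upwards [hu] with z hz; rw [hz])]

/-- The energy identities on almost every line, after mollification. -/
lemma IsWeakFluxSolution.ae_energy_mollX (hT : 0 < T) {uin : ℝ → ℝ} {v F : ℝ × ℝ → ℝ}
    (hv : Measurable v) (hF : Measurable F) (hv2 : MemLp v 2 (stripMeasure T))
    (hF2 : MemLp F 2 (stripMeasure T)) (h : IsWeakFluxSolution T uin v F)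
    {k : ℝ → ℝ} (hk : ContDiff ℝ ∞ k) (hkc : HasCompactSupport k) :
    ∀ᵐ x ∂volume,
      0 ≤ (∫ y, uin y * k (x - y)) ^ 2
        + 2 * ∫ t in Ioo 0 T, mollX (deriv k) F (t, x) * mollX k v (t, x) ∧
      ∫ t in Ioo 0 T, mollX k v (t, x) ^ 2 = T * (∫ y, uin y * k (x - y)) ^ 2
        + 2 * ∫ t in Ioo 0 T, (T - t) * (mollX (deriv k) F (t, x) * mollX k v (t, x)) := by
  have hkd : Continuous (deriv k) := hk.continuous_deriv (by simp)
  have m1 := memLp_mollX hk.continuous hkc hv hv2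
  have m2 := memLp_mollX hkd hkc.deriv hF hF2
  filter_upwards [ae_memLp_slice_left (measurable_mollX hk.continuous.measurable hv) m1,
    ae_memLp_slice_left (measurable_mollX hkd.measurable hF) m2] with x h1 h2
  have i1 : IntegrableOn (fun t => mollX k v (t, x)) (Ioo 0 T) := h1.integrable (by norm_num)
  have i2 : IntegrableOn (fun t => mollX (deriv k) F (t, x)) (Ioo 0 T) :=
    h2.integrable (by norm_num)
  -- At fixed `x`, the mollified `v` solves an ODE in `t` whose right-hand side is `F` convolved
  -- with `k'`, and whose initial value is the mollified datum at `x`.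
  refine energy_of_ae_eq_primitive hT i2 (ae_eq_primitive_of_weak hT i1 i2 ?_)
  intro χ hχ hχc hχs
  have hχd : Continuous (deriv χ) := hχ.continuous_deriv (by simp)
  have e := h (fun z => χ z.1 * k (x - z.2)) (by fun_prop) (hasCompactSupport_mul_comp hχc hkc x)
    ((tsupport_mul_comp_subset x).trans (prod_mono hχs le_rfl))
  simp only [partialX_mul_comp hχ hk, partialT_mul_comp hχ hk] at e
  obtain ⟨j1, e1⟩ := integral_mul_product_eq hχd hχc.deriv hk.continuous hkc hv2 x
  obtain ⟨j2, e2⟩ := integral_mul_product_eq hχ.continuous hχc hkd hkc.deriv hF2 x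
  have hb : ∀ f : ℝ → ℝ, Continuous f → HasCompactSupport f → ∀ r : ℝ → ℝ,
      IntegrableOn r (Ioo 0 T) → IntegrableOn (fun t => f t * r t) (Ioo 0 T) := by
    intro f hf hfc r hr
    obtain ⟨C, hC⟩ := hfc.exists_bound_of_continuous hf
    exact Integrable.bdd_mul (c := C) hr hf.aestronglyMeasurable (ae_of_all _ hC)
  have n1 : Integrable (fun t => -(deriv χ t * mollX k v (t, x))) (volume.restrict (Ioo 0 T)) :=
    (hb _ hχd hχc.deriv _ i1).neg
  have n2 : Integrable (fun z => -(v z * (deriv χ z.1 * k (x - z.2)))) (stripMeasure T) := j1.neg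
  rw [integral_sub n1 (hb _ hχ.continuous hχc _ i2), integral_neg,
    ← e1, ← e2]
  have e3 : ∫ y, uin y * (χ 0 * k (x - y)) = (∫ y, uin y * k (x - y)) * χ 0 := by
    rw [← integral_mul_const]; exact integral_congr_ae (ae_of_all _ fun y => by ring)
  rw [← e3, ← e, ← integral_neg, ← integral_sub n2 j2]
  exact integral_congr_ae (ae_of_all _ fun y => by ring)

/-- The weight is bounded by `|T|` on the strip. It depends on time only, so the weighted flux can
be mollified and integrated by parts in space like `F` itself. -/
lemma memLp_weight_mul {F : ℝ × ℝ → ℝ} (hF2 : MemLp F 2 (stripMeasure T)) :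
    MemLp (fun z => (T - z.1) * F z) 2 (stripMeasure T) := by
  refine hF2.of_le_mul (c := |T|) (AEStronglyMeasurable.mul (by fun_prop) hF2.1) ?_
  have : ∀ᵐ z ∂stripMeasure T, z.1 ∈ Ioo 0 T := by
    have : ∀ᵐ t ∂volume.restrict (Ioo 0 T), t ∈ Ioo 0 T := ae_restrict_mem measurableSet_Ioo
    exact Measure.quasiMeasurePreserving_fst.ae this
  filter_upwards [this] with z hz
  rw [norm_mul]
  refine mul_le_mul_of_nonneg_right ?_ (norm_nonneg _)
  rw [Real.norm_eq_abs, abs_of_nonneg (by linarith [hz.2]), abs_of_pos (hz.1.trans hz.2)]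
  linarith [hz.1]

lemma mollX_weight_mul (k : ℝ → ℝ) (F : ℝ × ℝ → ℝ) (z : ℝ × ℝ) :
    mollX k (fun z => (T - z.1) * F z) z = (T - z.1) * mollX k F z := by
  simp only [mollX, mul_assoc]
  rw [integral_const_mul]

/-- The energy identities on the strip, after mollification. -/
lemma IsWeakFluxSolution.energy_mollX (hT : 0 < T) {uin : ℝ → ℝ} {v g F : ℝ × ℝ → ℝ}
    (hu : Measurable uin) (hu2 : MemLp uin 2 volume)
    (hv : Measurable v) (hg : Measurable g) (hF : Measurable F) (hv2 : MemLp v 2 (stripMeasure T))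
    (hg2 : MemLp g 2 (stripMeasure T)) (hF2 : MemLp F 2 (stripMeasure T))
    (hw : IsWeakPartialX T v g) (h : IsWeakFluxSolution T uin v F)
    {k : ℝ → ℝ} (hk : ContDiff ℝ ∞ k) (hkc : HasCompactSupport k) :
    2 * ∫ z, mollX k F z * mollX k g z ∂stripMeasure T ≤ ∫ x, (∫ y, uin y * k (x - y)) ^ 2 ∧
    ∫ z, mollX k v z ^ 2 ∂stripMeasure T
      + 2 * ∫ z, mollX k (fun z => (T - z.1) * F z) z * mollX k g z ∂stripMeasure T
      = T * ∫ x, (∫ y, uin y * k (x - y)) ^ 2 := by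
  have hkd : Continuous (deriv k) := hk.continuous_deriv (by simp)
  have hG2 := memLp_weight_mul hF2
  have hG : Measurable fun z : ℝ × ℝ => (T - z.1) * F z := by fun_prop
  have p1 := integral_mollX_deriv_mul hv hg hF hv2 hg2 hF2 hw hk hkc
  have p2 := integral_mollX_deriv_mul hv hg hG hv2 hg2 hG2 hw hk hkc
  have i0 := ((memLp_convolution hu hu2 hk.continuous hkc).integrable_sq)
  have i1 : Integrable (fun z => mollX (deriv k) F z * mollX k v z) (stripMeasure T) :=
    (memLp_mollX hkd hkc.deriv hF hF2).integrable_mul (memLp_mollX hk.continuous hkc hv hv2)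
  have i2 : Integrable (fun z => (T - z.1) * (mollX (deriv k) F z * mollX k v z))
      (stripMeasure T) := by
    refine ((memLp_mollX hkd hkc.deriv hG hG2).integrable_mul
      (memLp_mollX hk.continuous hkc hv hv2)).congr (ae_of_all _ fun z => ?_)
    simp only [Pi.mul_apply, mollX_weight_mul, mul_assoc]
  have i3 := (memLp_mollX hk.continuous hkc hv hv2).integrable_sq
  simp only [mollX_weight_mul, mul_assoc] at p2 ⊢
  have hae := h.ae_energy_mollX hT hv hF hv2 hF2 hk hkc
  have s1 : ∫ z, mollX (deriv k) F z * mollX k v z ∂stripMeasure T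
      = ∫ x, ∫ t in Ioo 0 T, mollX (deriv k) F (t, x) * mollX k v (t, x) := by
    unfold stripMeasure at i1 ⊢; exact integral_prod_symm _ i1
  have s2 : ∫ z, (T - z.1) * (mollX (deriv k) F z * mollX k v z) ∂stripMeasure T
      = ∫ x, ∫ t in Ioo 0 T, (T - t) * (mollX (deriv k) F (t, x) * mollX k v (t, x)) := by
    unfold stripMeasure at i2 ⊢; exact integral_prod_symm _ i2
  have s3 : ∫ z, mollX k v z ^ 2 ∂stripMeasure T
      = ∫ x, ∫ t in Ioo 0 T, mollX k v (t, x) ^ 2 := by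
    unfold stripMeasure at i3 ⊢; exact integral_prod_symm _ i3
  constructor
  · have h0 : 0 ≤ ∫ x, ((∫ y, uin y * k (x - y)) ^ 2
        + 2 * ∫ t in Ioo 0 T, mollX (deriv k) F (t, x) * mollX k v (t, x)) :=
      integral_nonneg_of_ae (hae.mono fun x hx => hx.1)
    rw [integral_add i0 (by unfold stripMeasure at i1; exact i1.integral_prod_right.const_mul 2),
      integral_const_mul, ← s1, p1] at h0
    linarith
  · have h0 : ∫ x, ∫ t in Ioo 0 T, mollX k v (t, x) ^ 2 = _ :=
      integral_congr_ae (hae.mono fun x hx => hx.2)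
    rw [integral_add (i0.const_mul T)
      (by unfold stripMeasure at i2; exact i2.integral_prod_right.const_mul 2),
      integral_const_mul, integral_const_mul, ← s2, p2, ← s3] at h0
    linarith

/-- Passage to the limit in an energy inequality by Fatou's lemma. -/
lemma energy_le_of_tendsto {α : Type*} [MeasurableSpace α] {μ : Measure α} {c : ℝ}
    {A B W : ℕ → α → ℝ} {a b w : α → ℝ} (hA : ∀ n, MemLp (A n) 2 μ) (hB : ∀ n, MemLp (B n) 2 μ)
    (hW : ∀ n, MemLp (W n) 2 μ) (ha : MemLp a 2 μ) (hb : MemLp b 2 μ) (hw : MemLp w 2 μ)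
    (hAa : ∀ᵐ z ∂μ, Tendsto (fun n => A n z) atTop (𝓝 (a z)))
    (hBb : ∀ᵐ z ∂μ, Tendsto (fun n => B n z) atTop (𝓝 (b z)))
    (hWw : ∀ᵐ z ∂μ, Tendsto (fun n => W n z) atTop (𝓝 (w z)))
    (hAle : ∀ n, ∫ z, A n z ^ 2 ∂μ ≤ ∫ z, a z ^ 2 ∂μ)
    (hBle : ∀ n, ∫ z, B n z ^ 2 ∂μ ≤ ∫ z, b z ^ 2 ∂μ)
    (h : ∀ n, ∫ z, W n z ^ 2 ∂μ + 2 * ∫ z, A n z * B n z ∂μ ≤ c) :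
    ∫ z, w z ^ 2 ∂μ + 2 * ∫ z, a z * b z ∂μ ≤ c := by
  -- The product `A B` has no sign, so Fatou's lemma does not apply to it. Adding `A² + B²`
  -- completes the square, and the integrals of these added terms are bounded by those of their
  -- limits; they cancel at the end.
  have key : ∀ {A B W : α → ℝ}, MemLp A 2 μ → MemLp B 2 μ → MemLp W 2 μ →
      Integrable (fun z => W z ^ 2 + (A z + B z) ^ 2) μ ∧
      ∫ z, (W z ^ 2 + (A z + B z) ^ 2) ∂μ = ∫ z, W z ^ 2 ∂μ + 2 * ∫ z, A z * B z ∂μ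
        + ∫ z, A z ^ 2 ∂μ + ∫ z, B z ^ 2 ∂μ := by
    intro A B W hA hB hW
    have iA := hA.integrable_sq
    have iB := hB.integrable_sq
    have iW := hW.integrable_sq
    have iAB : Integrable (fun z => A z * B z) μ := hA.integrable_mul hB
    refine ⟨iW.add (hA.add hB).integrable_sq, ?_⟩
    have i1 : Integrable (fun z => W z ^ 2 + 2 * (A z * B z)) μ := iW.add (iAB.const_mul 2)
    have i2 : Integrable (fun z => W z ^ 2 + 2 * (A z * B z) + A z ^ 2) μ := i1.add iA
    rw [← integral_const_mul, ← integral_add iW (iAB.const_mul 2), ← integral_add i1 iA,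
      ← integral_add i2 iB]
    exact integral_congr_ae (ae_of_all _ fun z => by ring)
  set C := c + ∫ z, a z ^ 2 ∂μ + ∫ z, b z ^ 2 ∂μ with hC
  obtain ⟨i, e⟩ := key ha hb hw
  have hn : ∀ n, ∫ z, (W n z ^ 2 + (A n z + B n z) ^ 2) ∂μ ≤ C := fun n => by
    rw [(key (hA n) (hB n) (hW n)).2]
    linarith [h n, hAle n, hBle n]
  have hC0 : 0 ≤ C := (integral_nonneg fun z => by positivity).trans (hn 0)
  have hfatou : ∫⁻ z, ENNReal.ofReal (w z ^ 2 + (a z + b z) ^ 2) ∂μ ≤ ENNReal.ofReal C := by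
    calc ∫⁻ z, ENNReal.ofReal (w z ^ 2 + (a z + b z) ^ 2) ∂μ
        = ∫⁻ z, liminf (fun n => ENNReal.ofReal (W n z ^ 2 + (A n z + B n z) ^ 2)) atTop ∂μ := by
          refine lintegral_congr_ae ?_
          filter_upwards [hAa, hBb, hWw] with z h1 h2 h3
          exact ((ENNReal.continuous_ofReal.tendsto _).comp
            ((h3.pow 2).add ((h1.add h2).pow 2))).liminf_eq.symm
      _ ≤ liminf (fun n => ∫⁻ z, ENNReal.ofReal (W n z ^ 2 + (A n z + B n z) ^ 2) ∂μ) atTop :=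
          lintegral_liminf_le' fun n =>
            (key (hA n) (hB n) (hW n)).1.1.aemeasurable.ennreal_ofReal
      _ ≤ ENNReal.ofReal C := by
          refine liminf_le_of_le (by isBoundedDefault) fun b hb => ?_
          obtain ⟨n, hbn⟩ := hb.exists
          refine hbn.trans ?_
          rw [← ofReal_integral_eq_lintegral_ofReal (key (hA n) (hB n) (hW n)).1
            (ae_of_all _ fun z => by positivity)]
          exact ENNReal.ofReal_le_ofReal (hn n)
  rw [← ofReal_integral_eq_lintegral_ofReal i (ae_of_all _ fun z => by positivity),
    ENNReal.ofReal_le_ofReal_iff hC0, e] at hfatou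
  linarith

/-- Energy estimates for weak solutions of `∂v/∂t = ∂F/∂x` in `L²((0,T); H¹(ℝ))`. -/
theorem IsWeakFluxSolution.energy (hT : 0 < T) {uin : ℝ → ℝ} {v g F : ℝ × ℝ → ℝ}
    (hu2 : MemLp uin 2 volume) (hv2 : MemLp v 2 (stripMeasure T))
    (hg2 : MemLp g 2 (stripMeasure T)) (hF2 : MemLp F 2 (stripMeasure T))
    (hw : IsWeakPartialX T v g) (h : IsWeakFluxSolution T uin v F) :
    2 * ∫ z, F z * g z ∂stripMeasure T ≤ ∫ x, uin x ^ 2 ∧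
    ∫ z, v z ^ 2 ∂stripMeasure T + 2 * ∫ z, (T - z.1) * F z * g z ∂stripMeasure T
      ≤ T * ∫ x, uin x ^ 2 := by
  -- Both weak formulations and all the integrals are unchanged under almost everywhere
  -- modification, so measurable representatives suffice.
  wlog hm : Measurable uin ∧ Measurable v ∧ Measurable g ∧ Measurable F generalizing uin v g F
  · have eu := hu2.1.ae_eq_mk
    have ev := hv2.1.ae_eq_mk
    have eg := hg2.1.ae_eq_mk
    have eF := hF2.1.ae_eq_mk
    have := this (uin := hu2.1.mk) (v := hv2.1.mk) (g := hg2.1.mk) (F := hF2.1.mk)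
      (hu2.ae_eq eu) (hv2.ae_eq ev) (hg2.ae_eq eg) (hF2.ae_eq eF) (hw.congr ev eg)
      (h.congr eu ev eF)
      ⟨hu2.1.stronglyMeasurable_mk.measurable, hv2.1.stronglyMeasurable_mk.measurable,
        hg2.1.stronglyMeasurable_mk.measurable, hF2.1.stronglyMeasurable_mk.measurable⟩
    have q1 : ∫ z, F z * g z ∂stripMeasure T = ∫ z, hF2.1.mk F z * hg2.1.mk g z ∂stripMeasure T :=
      integral_congr_ae (by filter_upwards [eF, eg] with z h1 h2; rw [h1, h2])
    have q2 : ∫ z, (T - z.1) * F z * g z ∂stripMeasure T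
        = ∫ z, (T - z.1) * hF2.1.mk F z * hg2.1.mk g z ∂stripMeasure T :=
      integral_congr_ae (by filter_upwards [eF, eg] with z h1 h2; rw [h1, h2])
    have q3 : ∫ x, uin x ^ 2 = ∫ x, hu2.1.mk uin x ^ 2 :=
      integral_congr_ae (by filter_upwards [eu] with z h1; rw [h1])
    have q4 : ∫ z, v z ^ 2 ∂stripMeasure T = ∫ z, hv2.1.mk v z ^ 2 ∂stripMeasure T :=
      integral_congr_ae (by filter_upwards [ev] with z h1; rw [h1])
    rwa [q1, q2, q3, q4]
  obtain ⟨hu, hv, hg, hF⟩ := hm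
  obtain ⟨ρ, hρ, hρK⟩ := exists_bumps
  have hG2 := memLp_weight_mul hF2
  have hG : Measurable fun z : ℝ × ℝ => (T - z.1) * F z := by fun_prop
  have hmem : ∀ {f : ℝ × ℝ → ℝ}, Measurable f → MemLp f 2 (stripMeasure T) → ∀ n,
      MemLp (mollX ((ρ n).normed volume) f) 2 (stripMeasure T) := fun hf hf2 n =>
    memLp_mollX (ρ n).continuous_normed (ρ n).hasCompactSupport_normed hf hf2
  have hen := fun n => h.energy_mollX hT hu hu2 hv hg hF hv2 hg2 hF2 hw
    ((ρ n).contDiff_normed (μ := volume) (n := ⊤)) (ρ n).hasCompactSupport_normed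
  have hun := fun n => integral_convolution_normed_sq_le (ρ n) hu hu2
  constructor
  · have := energy_le_of_tendsto (W := fun _ _ => 0) (w := fun _ => 0) (c := ∫ x, uin x ^ 2)
      (hmem hF hF2) (hmem hg hg2) (fun _ => MemLp.zero') hF2 hg2 MemLp.zero'
      (ae_tendsto_mollX hρ hρK hF hF2) (ae_tendsto_mollX hρ hρK hg hg2)
      (ae_of_all _ fun _ => tendsto_const_nhds)
      (fun n => integral_mollX_sq_le (ρ n) hF hF2) (fun n => integral_mollX_sq_le (ρ n) hg hg2)
      (fun n => by simpa using (hen n).1.trans (hun n))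
    simpa using this
  · exact energy_le_of_tendsto (hmem hG hG2) (hmem hg hg2) (hmem hv hv2) hG2 hg2 hv2
      (ae_tendsto_mollX hρ hρK hG hG2) (ae_tendsto_mollX hρ hρK hg hg2)
      (ae_tendsto_mollX hρ hρK hv hv2)
      (fun n => integral_mollX_sq_le (ρ n) hG hG2) (fun n => integral_mollX_sq_le (ρ n) hg hg2)
      (fun n => (hen n).2.trans_le (mul_le_mul_of_nonneg_left (hun n) hT.le))

end LagrangianLimit

/-! ### Linear combinations and uniqueness for the heat equation. -/

namespace LagrangianLimit

variable {T : ℝ}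

lemma memLp_testFunction {φ : ℝ × ℝ → ℝ} (hφ : ContDiff ℝ ∞ φ) (hc : HasCompactSupport φ) :
    MemLp φ 2 (stripMeasure T) :=
  hφ.continuous.memLp_of_hasCompactSupport hc

lemma memLp_fderiv_apply {φ : ℝ × ℝ → ℝ} (hφ : ContDiff ℝ ∞ φ) (hc : HasCompactSupport φ)
    (w : ℝ × ℝ) : MemLp (fun z => fderiv ℝ φ z w) 2 (stripMeasure T) :=
  Continuous.memLp_of_hasCompactSupport ((hφ.continuous_fderiv (by simp)).clm_apply
    continuous_const) (hc.fderiv_apply ℝ w)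

lemma memLp_partialT {φ : ℝ × ℝ → ℝ} (hφ : ContDiff ℝ ∞ φ) (hc : HasCompactSupport φ) :
    MemLp (partialT φ) 2 (stripMeasure T) := memLp_fderiv_apply hφ hc _

lemma memLp_partialX {φ : ℝ × ℝ → ℝ} (hφ : ContDiff ℝ ∞ φ) (hc : HasCompactSupport φ) :
    MemLp (partialX φ) 2 (stripMeasure T) := memLp_fderiv_apply hφ hc _

lemma memLp_trace {φ : ℝ × ℝ → ℝ} (hφ : ContDiff ℝ ∞ φ) (hc : HasCompactSupport φ) :
    MemLp (fun x => φ (0, x)) 2 (volume : Measure ℝ) := by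
  refine Continuous.memLp_of_hasCompactSupport (by have := hφ.continuous; fun_prop) ?_
  refine HasCompactSupport.intro (hc.isCompact.image continuous_snd) fun x hx => ?_
  by_contra h0
  exact hx ⟨(0, x), subset_tsupport _ h0, rfl⟩

lemma integral_lincomb_mul {α : Type*} [MeasurableSpace α] {μ : Measure α} {f g p : α → ℝ}
    (hf : MemLp f 2 μ) (hg : MemLp g 2 μ) (hp : MemLp p 2 μ) (a b : ℝ) :
    ∫ z, (a * f z + b * g z) * p z ∂μ = a * ∫ z, f z * p z ∂μ + b * ∫ z, g z * p z ∂μ := by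
  have i1 : Integrable (fun z => f z * p z) μ := hf.integrable_mul hp
  have i2 : Integrable (fun z => g z * p z) μ := hg.integrable_mul hp
  rw [← integral_const_mul, ← integral_const_mul, ← integral_add (i1.const_mul a) (i2.const_mul b)]
  exact integral_congr_ae (ae_of_all _ fun z => by ring)

lemma IsWeakPartialX.lincomb {v v' g g' : ℝ × ℝ → ℝ} (h : IsWeakPartialX T v g)
    (h' : IsWeakPartialX T v' g') (hv : MemLp v 2 (stripMeasure T))
    (hv' : MemLp v' 2 (stripMeasure T)) (hg : MemLp g 2 (stripMeasure T))
    (hg' : MemLp g' 2 (stripMeasure T)) (a b : ℝ) :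
    IsWeakPartialX T (fun z => a * v z + b * v' z) (fun z => a * g z + b * g' z) := by
  intro φ hφ hc hs
  rw [integral_lincomb_mul hv hv' (memLp_partialX hφ hc), h φ hφ hc hs, h' φ hφ hc hs,
    integral_lincomb_mul hg hg' (memLp_testFunction hφ hc)]
  ring

lemma integral_flux {v F φ : ℝ × ℝ → ℝ} (hv : MemLp v 2 (stripMeasure T))
    (hF : MemLp F 2 (stripMeasure T)) (hφ : ContDiff ℝ ∞ φ) (hc : HasCompactSupport φ) :
    ∫ z, (-(v z * partialT φ z) + F z * partialX φ z) ∂stripMeasure T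
      = -∫ z, v z * partialT φ z ∂stripMeasure T + ∫ z, F z * partialX φ z ∂stripMeasure T := by
  have i1 : Integrable (fun z => -(v z * partialT φ z)) (stripMeasure T) :=
    (hv.integrable_mul (memLp_partialT hφ hc)).neg
  have i2 : Integrable (fun z => F z * partialX φ z) (stripMeasure T) :=
    hF.integrable_mul (memLp_partialX hφ hc)
  rw [integral_add i1 i2, integral_neg]

lemma memLp_lincomb {α : Type*} [MeasurableSpace α] {μ : Measure α} {f g : α → ℝ}
    (hf : MemLp f 2 μ) (hg : MemLp g 2 μ) (a b : ℝ) : MemLp (fun z => a * f z + b * g z) 2 μ :=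
  (hf.const_mul a).add (hg.const_mul b)

lemma IsWeakFluxSolution.lincomb {uin uin' : ℝ → ℝ} {v v' F F' : ℝ × ℝ → ℝ}
    (h : IsWeakFluxSolution T uin v F) (h' : IsWeakFluxSolution T uin' v' F')
    (hu : MemLp uin 2 volume) (hu' : MemLp uin' 2 volume)
    (hv : MemLp v 2 (stripMeasure T)) (hv' : MemLp v' 2 (stripMeasure T))
    (hF : MemLp F 2 (stripMeasure T)) (hF' : MemLp F' 2 (stripMeasure T)) (a b : ℝ) :
    IsWeakFluxSolution T (fun x => a * uin x + b * uin' x) (fun z => a * v z + b * v' z)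
      (fun z => a * F z + b * F' z) := by
  intro φ hφ hc hs
  have e := h φ hφ hc hs
  have e' := h' φ hφ hc hs
  rw [integral_flux hv hF hφ hc] at e
  rw [integral_flux hv' hF' hφ hc] at e'
  rw [integral_flux (memLp_lincomb hv hv' a b) (memLp_lincomb hF hF' a b) hφ hc,
    integral_lincomb_mul hv hv' (memLp_partialT hφ hc),
    integral_lincomb_mul hF hF' (memLp_partialX hφ hc),
    integral_lincomb_mul hu hu' (memLp_trace hφ hc), ← e, ← e']
  ring

lemma isWeakSolution_zero_iff {c : ℝ} {uin : ℝ → ℝ} {u : ℝ × ℝ → ℝ} :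
    IsWeakSolution T 0 (fun _ => c) uin u ↔ MemLp u 2 (stripMeasure T) ∧
      ∃ g, MemLp g 2 (stripMeasure T) ∧ IsWeakPartialX T u g ∧
        IsWeakFluxSolution T uin u (fun z => c * g z) := by
  simp only [IsWeakSolution, IsWeakFluxSolution, zero_mul, sub_zero]

lemma ae_strip_mem : ∀ᵐ z ∂stripMeasure T, z.1 ∈ Ioo 0 T :=
  Measure.quasiMeasurePreserving_fst.ae (ae_restrict_mem measurableSet_Ioo)

/-- Uniqueness for the heat equation in `L²((0,T); H¹(ℝ))`. -/
lemma IsWeakSolution.ae_eq (hT : 0 < T) {c : ℝ} (hc : 0 ≤ c) {uin : ℝ → ℝ}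
    (hu : MemLp uin 2 volume) {v v' : ℝ × ℝ → ℝ} (h : IsWeakSolution T 0 (fun _ => c) uin v)
    (h' : IsWeakSolution T 0 (fun _ => c) uin v') : v =ᵐ[stripMeasure T] v' := by
  obtain ⟨hv, g, hg, hw, hs⟩ := isWeakSolution_zero_iff.1 h
  obtain ⟨hv', g', hg', hw', hs'⟩ := isWeakSolution_zero_iff.1 h'
  have hV := memLp_lincomb hv hv' 1 (-1)
  have := (IsWeakFluxSolution.energy hT (memLp_lincomb hu hu 1 (-1)) hV
    (memLp_lincomb hg hg' 1 (-1)) (memLp_lincomb (hg.const_mul c) (hg'.const_mul c) 1 (-1))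
    (hw.lincomb hw' hv hv' hg hg' 1 (-1))
    (hs.lincomb hs' hu hu hv hv' (hg.const_mul c) (hg'.const_mul c) 1 (-1))).2
  have h0 : ∫ x, (1 * uin x + -1 * uin x) ^ 2 = 0 := by simp
  have h1 : 0 ≤ ∫ z, (T - z.1) * (1 * (c * g z) + -1 * (c * g' z)) * (1 * g z + -1 * g' z)
      ∂stripMeasure T := by
    refine integral_nonneg_of_ae ?_
    filter_upwards [ae_strip_mem] with z hz
    have : 0 ≤ T - z.1 := by linarith [hz.2]
    calc (0 : ℝ) ≤ (T - z.1) * (c * (g z - g' z) ^ 2) := by positivity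
      _ = _ := by ring
  rw [h0] at this
  have h2 : ∫ z, (1 * v z + -1 * v' z) ^ 2 ∂stripMeasure T = 0 :=
    le_antisymm (by linarith) (integral_nonneg fun z => sq_nonneg _)
  rw [integral_eq_zero_iff_of_nonneg (fun z => sq_nonneg _) hV.integrable_sq] at h2
  filter_upwards [h2] with z hz
  have : 1 * v z + -1 * v' z = 0 := by simpa using hz
  linarith

/-! ### The change to the moving frame. -/

section Shear

/-- The shear `(t, x) ↦ (t, x + b t)`. -/
noncomputable def shear (b : ℝ) : (ℝ × ℝ) ≃L[ℝ] (ℝ × ℝ) :=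
  ContinuousLinearEquiv.equivOfInverse
    ((ContinuousLinearMap.fst ℝ ℝ ℝ).prod
      (ContinuousLinearMap.snd ℝ ℝ ℝ + b • ContinuousLinearMap.fst ℝ ℝ ℝ))
    ((ContinuousLinearMap.fst ℝ ℝ ℝ).prod
      (ContinuousLinearMap.snd ℝ ℝ ℝ - b • ContinuousLinearMap.fst ℝ ℝ ℝ))
    (fun z => by ext <;> simp) (fun z => by ext <;> simp)

lemma shear_apply (b : ℝ) (z : ℝ × ℝ) : shear b z = (z.1, z.2 + b * z.1) := rfl

lemma shear_symm_apply (b : ℝ) (z : ℝ × ℝ) : (shear b).symm z = (z.1, z.2 - b * z.1) := rfl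

lemma measurePreserving_shear (b : ℝ) :
    MeasurePreserving (shear b) (stripMeasure T) (stripMeasure T) := by
  refine (MeasurePreserving.id (volume.restrict (Ioo 0 T))).skew_product
    (g := fun t x => x + b * t) (show Measurable fun z : ℝ × ℝ => z.2 + b * z.1 by fun_prop) (ae_of_all _ fun t => ?_)
  exact map_add_right_eq_self volume (b * t)

lemma measurableEmbedding_shear (b : ℝ) : MeasurableEmbedding (shear b) :=
  (shear b).toHomeomorph.measurableEmbedding

lemma integral_comp_shear (b : ℝ) (f : ℝ × ℝ → ℝ) :
    ∫ z, f (shear b z) ∂stripMeasure T = ∫ z, f z ∂stripMeasure T :=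
  (measurePreserving_shear b).integral_comp (measurableEmbedding_shear b) f

variable {φ : ℝ × ℝ → ℝ} {b : ℝ}

lemma fderiv_comp_shear_symm (hφ : ContDiff ℝ ∞ φ) (z w : ℝ × ℝ) :
    fderiv ℝ (fun z => φ ((shear b).symm z)) (shear b z) w
      = fderiv ℝ φ z ((shear b).symm w) := by
  have h : HasFDerivAt (fun z => φ ((shear b).symm z))
      ((fderiv ℝ φ z).comp ((shear b).symm : (ℝ × ℝ) →L[ℝ] ℝ × ℝ)) (shear b z) := by
    refine HasFDerivAt.comp (shear b z) ?_ (shear b).symm.hasFDerivAt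
    rw [ContinuousLinearEquiv.symm_apply_apply]
    exact (hφ.differentiable (by simp) z).hasFDerivAt
  rw [h.fderiv]
  rfl

lemma partialX_comp_shear_symm (hφ : ContDiff ℝ ∞ φ) (z : ℝ × ℝ) :
    partialX (fun z => φ ((shear b).symm z)) (shear b z) = partialX φ z := by
  simp only [partialX, fderiv_comp_shear_symm hφ]
  simp [shear_symm_apply]

/-- The extra term `-b ∂φ/∂x` from the chain rule is what cancels the drift in the weak formulation.
-/
lemma partialT_comp_shear_symm (hφ : ContDiff ℝ ∞ φ) (z : ℝ × ℝ) :
    partialT (fun z => φ ((shear b).symm z)) (shear b z) = partialT φ z - b * partialX φ z := by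
  simp only [partialT, partialX, fderiv_comp_shear_symm hφ]
  have : (shear b).symm (1, 0) = (1, 0) - b • ((0 : ℝ), (1 : ℝ)) := by simp [shear_symm_apply]
  rw [this, map_sub, map_smul, smul_eq_mul]

lemma tsupport_comp_shear_symm {s : Set ℝ} (hs : tsupport φ ⊆ s ×ˢ univ) :
    tsupport (fun z => φ ((shear b).symm z)) ⊆ s ×ˢ univ := by
  have h : tsupport (fun z => φ ((shear b).symm z)) ⊆ (shear b).symm ⁻¹' tsupport φ :=
    tsupport_comp_subset_preimage φ (shear b).symm.continuous
  exact fun z hz => ⟨(hs (h hz)).1, trivial⟩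

lemma hasCompactSupport_comp_shear_symm (hc : HasCompactSupport φ) :
    HasCompactSupport fun z => φ ((shear b).symm z) :=
  hc.comp_homeomorph (shear b).symm.toHomeomorph

end Shear

/-- In the moving frame the drift disappears. -/
lemma IsWeakSolution.moving_frame {b : ℝ} {a uin : ℝ → ℝ} {u : ℝ × ℝ → ℝ}
    (h : IsWeakSolution T b a uin u) :
    MemLp (fun z => u (shear b z)) 2 (stripMeasure T) ∧
      ∃ g, MemLp g 2 (stripMeasure T) ∧ IsWeakPartialX T (fun z => u (shear b z)) g ∧
        IsWeakFluxSolution T uin (fun z => u (shear b z)) (fun z => a (shear b z).2 * g z) := by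
  obtain ⟨hu, g, hg, hw, hs⟩ := h
  refine ⟨hu.comp_measurePreserving (measurePreserving_shear b), fun z => g (shear b z),
    hg.comp_measurePreserving (measurePreserving_shear b), ?_, ?_⟩
  · intro φ hφ hc hsup
    have hφ' : ContDiff ℝ ∞ fun z => φ ((shear b).symm z) := hφ.comp (shear b).symm.contDiff
    have e := hw _ hφ' (hasCompactSupport_comp_shear_symm hc) (tsupport_comp_shear_symm hsup)
    rw [← integral_comp_shear b, ← integral_comp_shear b (fun z => g z * φ ((shear b).symm z))] at e
    simpa only [partialX_comp_shear_symm hφ, ContinuousLinearEquiv.symm_apply_apply] using e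
  · intro φ hφ hc hsup
    have hφ' : ContDiff ℝ ∞ fun z => φ ((shear b).symm z) := hφ.comp (shear b).symm.contDiff
    have e := hs _ hφ' (hasCompactSupport_comp_shear_symm hc) (tsupport_comp_shear_symm hsup)
    rw [← integral_comp_shear b] at e
    -- The shear is the identity at `t = 0`, so the initial datum is unchanged.
    have h0 : ∀ x : ℝ, (shear b).symm (0, x) = (0, x) := fun x => by simp [shear_symm_apply]
    simp only [partialX_comp_shear_symm hφ, partialT_comp_shear_symm hφ, h0] at e
    rw [← e]
    exact integral_congr_ae (ae_of_all _ fun z => by ring)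

/-! ### Weak compactness in `L²`. -/

section Hilbert

variable {α : Type*} [MeasurableSpace α] {μ : Measure α}

lemma inner_toLp {f g : α → ℝ} (hf : MemLp f 2 μ) (hg : MemLp g 2 μ) :
    inner ℝ (hf.toLp f) (hg.toLp g) = ∫ z, f z * g z ∂μ := by
  rw [L2.inner_def]
  refine integral_congr_ae ?_
  filter_upwards [hf.coeFn_toLp, hg.coeFn_toLp] with z h1 h2
  rw [h1, h2]
  simp [mul_comm]

lemma sq_integral_mul_le {f g : α → ℝ} (hf : MemLp f 2 μ) (hg : MemLp g 2 μ) :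
    (∫ z, f z * g z ∂μ) ^ 2 ≤ (∫ z, f z ^ 2 ∂μ) * ∫ z, g z ^ 2 ∂μ := by
  have := real_inner_mul_inner_self_le (hf.toLp f) (hg.toLp g)
  simpa only [inner_toLp, ← sq] using this

/-- A bounded sequence paired with one tending strongly to zero, by Cauchy–Schwarz. -/
lemma tendsto_integral_mul_zero {f h : ℕ → α → ℝ} {C : ℝ} (hf : ∀ n, MemLp (f n) 2 μ)
    (hC : ∀ n, ∫ z, f n z ^ 2 ∂μ ≤ C) (hh : ∀ n, MemLp (h n) 2 μ)
    (h0 : Tendsto (fun n => ∫ z, h n z ^ 2 ∂μ) atTop (𝓝 0)) :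
    Tendsto (fun n => ∫ z, f n z * h n z ∂μ) atTop (𝓝 0) := by
  have h1 : Tendsto (fun n => (∫ z, f n z * h n z ∂μ) ^ 2) atTop (𝓝 0) := by
    refine squeeze_zero (fun n => sq_nonneg _) (fun n => (sq_integral_mul_le (hf n) (hh n)).trans
      (mul_le_mul_of_nonneg_right (hC n) (integral_nonneg fun z => sq_nonneg _))) ?_
    simpa using h0.const_mul C
  have h2 := (Real.continuous_sqrt.tendsto 0).comp h1
  simp only [Function.comp_def, Real.sqrt_sq_eq_abs, Real.sqrt_zero] at h2
  exact (tendsto_zero_iff_abs_tendsto_zero _).2 h2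

/-- Weak compactness of bounded sequences in `L²`, along an ultrafilter. -/
lemma exists_weak_limit {f : ℕ → α → ℝ} {C : ℝ} (hf : ∀ n, MemLp (f n) 2 μ)
    (hC : ∀ n, ∫ z, f n z ^ 2 ∂μ ≤ C) (U : Ultrafilter ℕ) :
    ∃ f₀ : α → ℝ, MemLp f₀ 2 μ ∧ ∀ ψ : α → ℝ, MemLp ψ 2 μ →
      Tendsto (fun n => ∫ z, f n z * ψ z ∂μ) U (𝓝 (∫ z, f₀ z * ψ z ∂μ)) := by
  let x : ℕ → WeakDual ℝ (Lp ℝ 2 μ) := fun n =>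
    StrongDual.toWeakDual (InnerProductSpace.toDual ℝ _ ((hf n).toLp (f n)))
  have hx : ∀ n, x n ∈ WeakDual.toStrongDual ⁻¹' Metric.closedBall
      (0 : StrongDual ℝ (Lp ℝ 2 μ)) (√C) := by
    intro n
    rw [mem_preimage, mem_closedBall_zero_iff]
    change ‖InnerProductSpace.toDual ℝ _ ((hf n).toLp (f n))‖ ≤ √C
    rw [LinearIsometryEquiv.norm_map]
    refine Real.le_sqrt_of_sq_le ?_
    rw [← real_inner_self_eq_norm_sq, inner_toLp]
    simpa only [← sq] using hC n
  -- Banach–Alaoglu in the dual, with the Riesz isometry to return to `L²`. Along an ultrafilter no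
  -- subsequence has to be extracted.
  obtain ⟨l, -, hl⟩ := (WeakDual.isCompact_closedBall (0 : StrongDual ℝ (Lp ℝ 2 μ))
    (√C)).ultrafilter_le_nhds' (U.map x) (Eventually.of_forall (f := (U : Filter ℕ)) hx)
  have hl' : Tendsto x U (𝓝 l) := hl
  set y : Lp ℝ 2 μ := (InnerProductSpace.toDual ℝ _).symm (WeakDual.toStrongDual l) with hy
  refine ⟨y, Lp.memLp y, fun ψ hψ => ?_⟩
  have h1 : Tendsto (fun n => x n (hψ.toLp ψ)) U (𝓝 (l (hψ.toLp ψ))) :=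
    ((WeakDual.eval_continuous (𝕜 := ℝ) (hψ.toLp ψ)).tendsto l).comp hl'
  have h2 : ∀ n, x n (hψ.toLp ψ) = ∫ z, f n z * ψ z ∂μ := fun n => by
    rw [← inner_toLp (hf n) hψ]; rfl
  have h3 : l (hψ.toLp ψ) = ∫ z, y z * ψ z ∂μ := by
    rw [← inner_toLp (Lp.memLp y) hψ, Lp.toLp_coeFn, hy, InnerProductSpace.toDual_symm_apply]
    rfl
  simpa only [h2, h3] using h1

end Hilbert

end LagrangianLimit

namespace LagrangianLimit

variable {T : ℝ}

/-! ### The coefficient on the annuli. -/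

section Coefficient

lemma diffusionCoeff_mem (x : ℝ) : diffusionCoeff x ∈ Icc (1 : ℝ) 2 := by
  unfold diffusionCoeff; split_ifs <;> norm_num

lemma measurable_diffusionCoeff : Measurable diffusionCoeff := by
  refine Measurable.ite ?_ measurable_const measurable_const
  rw [ofPred_exists]
  exact MeasurableSet.iUnion fun n => measurableSet_Ico.preimage measurable_abs

lemma diffusionCoeff_eq_one {x : ℝ} {n : ℕ}
    (h : |x| ∈ Ico ((2 : ℝ) ^ ((2 * n) ^ 2)) ((2 : ℝ) ^ ((2 * n + 1) ^ 2))) :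
    diffusionCoeff x = 1 :=
  if_pos ⟨n, h⟩

lemma diffusionCoeff_eq_two {x : ℝ} {n : ℕ}
    (h : |x| ∈ Ico ((2 : ℝ) ^ ((2 * n + 1) ^ 2)) ((2 : ℝ) ^ ((2 * n + 1 + 1) ^ 2))) :
    diffusionCoeff x = 2 := by
  refine if_neg ?_
  rintro ⟨m, hm⟩
  rcases le_or_gt m n with hmn | hmn
  · have : (2 : ℝ) ^ ((2 * m + 1) ^ 2) ≤ 2 ^ ((2 * n + 1) ^ 2) :=
      pow_le_pow_right₀ one_le_two (Nat.pow_le_pow_left (by omega) 2)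
    linarith [hm.2, h.1]
  · have : (2 : ℝ) ^ ((2 * n + 1 + 1) ^ 2) ≤ 2 ^ ((2 * m) ^ 2) :=
      pow_le_pow_right₀ one_le_two (Nat.pow_le_pow_left (by omega) 2)
    linarith [hm.1, h.2]

lemma tendsto_scale : Tendsto (fun k : ℕ => (2 : ℝ) ^ ((k + 1) ^ 2)) atTop atTop := by
  refine (tendsto_pow_atTop_atTop_of_one_lt one_lt_two).comp
    (tendsto_atTop_mono (fun k => ?_) tendsto_id)
  simp only [id_eq]
  nlinarith

/-- The ratio is `2^(-(2k+1))`: the squares in the exponents make the inner radius negligible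
against the outer one. -/
lemma tendsto_scale_ratio :
    Tendsto (fun k : ℕ => (2 : ℝ) ^ (k ^ 2) / 2 ^ ((k + 1) ^ 2)) atTop (𝓝 0) := by
  have h : Tendsto (fun k : ℕ => ((1 : ℝ) / 2) ^ (2 * k + 1)) atTop (𝓝 0) :=
    (tendsto_pow_atTop_nhds_zero_of_lt_one (by norm_num) (by norm_num)).comp
      (tendsto_atTop_mono (fun k => by simp only [id_eq]; omega) tendsto_id)
  refine h.congr fun k => ?_
  rw [show (k + 1) ^ 2 = k ^ 2 + (2 * k + 1) by ring, pow_add, one_div, inv_pow]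
  field_simp
  ring

/-- A point moving at the scale `2^((k+1)²)` eventually lies in the `k`-th annulus. -/
lemma eventually_mem_annulus {s : ℝ} (hs : 0 < s) (hs1 : s < 1) (x : ℝ) :
    ∀ᶠ k : ℕ in atTop, |x + s * 2 ^ ((k + 1) ^ 2)| ∈
      Ico ((2 : ℝ) ^ (k ^ 2)) ((2 : ℝ) ^ ((k + 1) ^ 2)) := by
  -- With outer radius `M` and inner radius `m`, the first and third conditions give `x + sM ≥ sM/2
  -- > m`; the second gives `x + sM < M`.
  filter_upwards [tendsto_scale.eventually_ge_atTop (2 * |x| / s),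
    tendsto_scale.eventually_gt_atTop (|x| / (1 - s)),
    tendsto_scale_ratio.eventually (gt_mem_nhds (half_pos hs))] with k h1 h2 h3
  have hM : (0 : ℝ) < 2 ^ ((k + 1) ^ 2) := by positivity
  rw [div_le_iff₀ hs] at h1
  rw [div_lt_iff₀ (by linarith)] at h2
  rw [div_lt_iff₀ hM] at h3
  generalize (2 : ℝ) ^ ((k + 1) ^ 2) = M at *
  generalize (2 : ℝ) ^ (k ^ 2) = m at *
  have hx1 := neg_abs_le x
  have hx2 := le_abs_self x
  have hx0 := abs_nonneg x
  have hpos : 0 ≤ x + s * M := by nlinarith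
  rw [abs_of_nonneg hpos]
  constructor <;> nlinarith

end Coefficient

/-! ### Passage to the limit in the moving frame. -/

/-- Weak convergence of solutions whose coefficients converge pointwise to a constant. -/
theorem exists_weak_limit_of_coefficients_tendsto (hT : 0 < T) {c : ℝ} (hc : 0 ≤ c)
    {A : ℕ → ℝ × ℝ → ℝ} (hA : ∀ n, Measurable (A n)) (hA12 : ∀ n z, A n z ∈ Icc (1 : ℝ) 2)
    (hlim : ∀ z : ℝ × ℝ, z.1 ∈ Ioo 0 T → ∀ᶠ n in atTop, A n z = c)
    {uin : ℝ → ℝ} (hu : MemLp uin 2 volume) {v g : ℕ → ℝ × ℝ → ℝ}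
    (hv : ∀ n, MemLp (v n) 2 (stripMeasure T)) (hg : ∀ n, MemLp (g n) 2 (stripMeasure T))
    (hw : ∀ n, IsWeakPartialX T (v n) (g n))
    (hs : ∀ n, IsWeakFluxSolution T uin (v n) (fun z => A n z * g n z)) :
    ∃ u₀, WeaklyConvergesL2 T v u₀ ∧ IsWeakSolution T 0 (fun _ => c) uin u₀ := by
  have hAg : ∀ {f : ℝ × ℝ → ℝ}, MemLp f 2 (stripMeasure T) → ∀ n,
      MemLp (fun z => A n z * f z) 2 (stripMeasure T) := by
    intro f hf n
    refine hf.of_le_mul (c := 2) ((hA n).aestronglyMeasurable.mul hf.1) (ae_of_all _ fun z => ?_)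
    rw [norm_mul]
    refine mul_le_mul_of_nonneg_right ?_ (norm_nonneg _)
    rw [Real.norm_eq_abs, abs_of_nonneg (by linarith [(hA12 n z).1])]
    exact (hA12 n z).2
  have hen := fun n => (hs n).energy hT hu (hv n) (hg n) (hAg (hg n) n) (hw n)
  have hgC : ∀ n, ∫ z, g n z ^ 2 ∂stripMeasure T ≤ ∫ x, uin x ^ 2 := by
    intro n
    have h1 : ∫ z, g n z ^ 2 ∂stripMeasure T ≤ ∫ z, A n z * g n z * g n z ∂stripMeasure T := by
      refine integral_mono (hg n).integrable_sq ((hAg (hg n) n).integrable_mul (hg n)) fun z => ?_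
      simp only
      nlinarith [(hA12 n z).1, mul_nonneg (sub_nonneg.2 (hA12 n z).1) (sq_nonneg (g n z))]
    have h2 : 0 ≤ ∫ z, g n z ^ 2 ∂stripMeasure T := integral_nonneg fun z => sq_nonneg _
    linarith [(hen n).1]
  have hvC : ∀ n, ∫ z, v n z ^ 2 ∂stripMeasure T ≤ T * ∫ x, uin x ^ 2 := by
    intro n
    have h1 : 0 ≤ ∫ z, (T - z.1) * (A n z * g n z) * g n z ∂stripMeasure T := by
      refine integral_nonneg_of_ae ?_
      filter_upwards [ae_strip_mem] with z hz
      have h0 : 0 ≤ T - z.1 := by linarith [hz.2]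
      have h1 : 0 ≤ A n z := by linarith [(hA12 n z).1]
      calc (0 : ℝ) ≤ (T - z.1) * (A n z * g n z ^ 2) := by positivity
        _ = _ := by ring
    linarith [(hen n).2]
  -- The gradients converge only weakly, so the coefficient is moved onto the test function: `A n p
  -- → c p` strongly in `L²` by dominated convergence.
  have hcoef : ∀ p : ℝ × ℝ → ℝ, MemLp p 2 (stripMeasure T) →
      Tendsto (fun n => ∫ z, g n z * (A n z * p z + -c * p z) ∂stripMeasure T) atTop (𝓝 0) := by
    intro p hp
    have hm : ∀ n, MemLp (fun z => A n z * p z + -c * p z) 2 (stripMeasure T) := fun n =>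
      (hAg hp n).add (hp.const_mul (-c))
    refine tendsto_integral_mul_zero hg hgC hm ?_
    have h0 : ∫ _, (0 : ℝ) ∂stripMeasure T = 0 := integral_zero _ _
    rw [← h0]
    refine tendsto_integral_of_dominated_convergence (fun z => (2 + c) ^ 2 * p z ^ 2)
      (fun n => ((hm n).1.pow 2)) (hp.integrable_sq.const_mul _) (fun n => ae_of_all _ fun z => ?_) ?_
    · rw [Real.norm_eq_abs, abs_of_nonneg (sq_nonneg _),
        show A n z * p z + -c * p z = (A n z - c) * p z by ring, mul_pow]
      refine mul_le_mul_of_nonneg_right ?_ (sq_nonneg _)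
      exact sq_le_sq' (by linarith [(hA12 n z).1]) (by linarith [(hA12 n z).2])
    · filter_upwards [ae_strip_mem] with z hz
      refine tendsto_const_nhds.congr' ?_
      filter_upwards [hlim z hz] with n hn
      rw [hn]; ring
  have hU : ∀ U : Ultrafilter ℕ, (U : Filter ℕ) ≤ atTop → ∃ w : ℝ × ℝ → ℝ,
      IsWeakSolution T 0 (fun _ => c) uin w ∧
      ∀ ψ : ℝ × ℝ → ℝ, MemLp ψ 2 (stripMeasure T) →
        Tendsto (fun n => ∫ z, v n z * ψ z ∂stripMeasure T) U
          (𝓝 (∫ z, w z * ψ z ∂stripMeasure T)) := by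
    intro U hUle
    obtain ⟨w, hwm, hwl⟩ := exists_weak_limit hv hvC U
    obtain ⟨q, hqm, hql⟩ := exists_weak_limit hg hgC U
    refine ⟨w, isWeakSolution_zero_iff.2 ⟨hwm, q, hqm, ?_, ?_⟩, hwl⟩
    · intro φ hφ hφc hsup
      refine tendsto_nhds_unique (hwl _ (memLp_partialX hφ hφc)) ?_
      refine (hql _ (memLp_testFunction hφ hφc)).neg.congr fun n => ?_
      exact (hw n φ hφ hφc hsup).symm
    · intro φ hφ hφc hsup
      have hpT : MemLp (partialT φ) 2 (stripMeasure T) := memLp_partialT hφ hφc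
      have hpX : MemLp (partialX φ) 2 (stripMeasure T) := memLp_partialX hφ hφc
      rw [integral_flux hwm (hqm.const_mul c) hφ hφc]
      have l1 := (hwl _ hpT).neg
      have l2 := ((hql _ hpX).const_mul c).add ((hcoef _ hpX).mono_left hUle)
      have l3 := l1.add l2
      have e : ∀ n, -∫ z, v n z * partialT φ z ∂stripMeasure T
          + (c * ∫ z, g n z * partialX φ z ∂stripMeasure T
          + ∫ z, g n z * (A n z * partialX φ z + -c * partialX φ z) ∂stripMeasure T)
          = ∫ x, uin x * φ (0, x) := by
        intro n
        rw [← hs n φ hφ hφc hsup, integral_flux (hv n) (hAg (hg n) n) hφ hφc]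
        have i1 : Integrable (fun z => g n z * partialX φ z) (stripMeasure T) :=
          (hg n).integrable_mul hpX
        have i2 : Integrable (fun z => g n z * (A n z * partialX φ z + -c * partialX φ z))
            (stripMeasure T) := (hg n).integrable_mul ((hAg hpX n).add (hpX.const_mul (-c)))
        rw [← integral_const_mul, ← integral_add (i1.const_mul c) i2]
        congr 1
        exact integral_congr_ae (ae_of_all _ fun z => by ring)
      have := tendsto_nhds_unique l3 (tendsto_const_nhds.congr fun n => (e n).symm)
      rw [← this, add_zero, ← integral_const_mul]
      congr 1
      exact integral_congr_ae (ae_of_all _ fun z => by ring)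
  obtain ⟨u₀, hu₀, -⟩ := hU (hyperfilter ℕ) Nat.hyperfilter_le_atTop
  refine ⟨u₀, ⟨hv, hu₀.1, fun ψ hψ => ?_⟩, hu₀⟩
  -- Every ultrafilter limit solves the same heat equation with the same datum, hence equals `u₀`;
  -- this gives convergence of the full sequence.
  rw [tendsto_iff_ultrafilter]
  intro U hUle
  obtain ⟨w, hws, hwl⟩ := hU U hUle
  have := hwl ψ hψ
  rwa [integral_congr_ae (g := fun z => u₀ z * ψ z)] at this
  filter_upwards [IsWeakSolution.ae_eq hT hc hu hws hu₀] with z hz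
  rw [hz]

lemma lagrangian_eq (e : ℝ) (u : ℝ × ℝ → ℝ) : lagrangian e u = fun z => u (shear (1 / e) z) := by
  funext z
  rw [lagrangian, shear_apply, one_div_mul_eq_div]

/-- Weak limit of solutions in the moving frame along velocities `1 / ε n` for which the
coefficient seen by moving points becomes constant. -/
theorem exists_lagrangian_limit (hT : 0 < T) {c : ℝ} (hc : 0 ≤ c) {ε : ℕ → ℝ}
    (hε : ∀ n, 0 < ε n)
    (hlim : ∀ z : ℝ × ℝ, z.1 ∈ Ioo 0 T → ∀ᶠ n in atTop, diffusionCoeff (z.2 + z.1 / ε n) = c)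
    {uin : ℝ → ℝ} (hu : MemLp uin 2 volume) {u : ℝ → ℝ × ℝ → ℝ}
    (h : ∀ e : ℝ, 0 < e → IsWeakSolution T (1 / e) diffusionCoeff uin (u e)) :
    ∃ u₀, WeaklyConvergesL2 T (fun n => lagrangian (ε n) (u (ε n))) u₀ ∧
      IsWeakSolution T 0 (fun _ => c) uin u₀ := by
  choose hv g hg hw hs using fun n => (h (ε n) (hε n)).moving_frame
  simp only [lagrangian_eq]
  refine exists_weak_limit_of_coefficients_tendsto hT hc
    (A := fun n z => diffusionCoeff (shear (1 / ε n) z).2)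
    (fun n => measurable_diffusionCoeff.comp (shear (1 / ε n)).continuous.measurable.snd)
    (fun n z => diffusionCoeff_mem _) (fun z hz => ?_) hu hv hg hw hs
  filter_upwards [hlim z hz] with n hn
  rw [← hn, shear_apply, one_div_mul_eq_div]

/-! ### The two limits are distinct. -/

section Distinct

lemma eq_zero_of_forall_add_mul_le {p q E : ℝ} (h : ∀ r : ℝ, p + r * q ≤ E) : q = 0 := by
  by_contra hq
  have := h ((E - p + 1) / q)
  rw [div_mul_cancel₀ _ hq] at this
  linarith

/-- A datum with a constant weak solution in `L²` vanishes. -/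
lemma ae_eq_zero_of_isWeakFluxSolution_zero (hT : 0 < T) {uin : ℝ → ℝ} {v : ℝ × ℝ → ℝ}
    (hu2 : MemLp uin 2 volume) (hv2 : MemLp v 2 (stripMeasure T))
    (hw : IsWeakPartialX T v fun _ => 0) (h : IsWeakFluxSolution T uin v fun _ => 0) :
    uin =ᵐ[volume] 0 := by
  wlog hm : Measurable uin ∧ Measurable v generalizing uin v
  · exact hu2.1.ae_eq_mk.trans (this (hu2.ae_eq hu2.1.ae_eq_mk) (hv2.ae_eq hv2.1.ae_eq_mk)
      (hw.congr hv2.1.ae_eq_mk ae_eq_rfl) (h.congr hu2.1.ae_eq_mk hv2.1.ae_eq_mk ae_eq_rfl)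
      ⟨hu2.1.stronglyMeasurable_mk.measurable, hv2.1.stronglyMeasurable_mk.measurable⟩)
  obtain ⟨hu, hv⟩ := hm
  have hloc : LocallyIntegrable uin volume := hu2.locallyIntegrable (by norm_num)
  have key : ∀ k : ℝ → ℝ, ContDiff ℝ ∞ k → HasCompactSupport k →
      ∀ x, ∫ y, uin y * k (x - y) = 0 := by
    intro k hk hkc
    have hkd : ContDiff ℝ ∞ (deriv k) := (contDiff_infty_iff_deriv.1 hk).2
    -- The kernel is `k'`. Since `v` convolved with `k'` is its zero weak derivative convolved with
    -- `k`, the energy identity forces `uin` convolved with `k'` to vanish.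
    have h1 := (h.energy_mollX hT hu hu2 hv measurable_const measurable_const hv2 MemLp.zero'
      MemLp.zero' hw hkd hkc.deriv).2
    have h2 : ∫ z, mollX (deriv k) v z ^ 2 ∂stripMeasure T = 0 := by
      rw [integral_congr_ae (g := fun _ => 0), integral_zero]
      filter_upwards [mollX_deriv_ae_eq hv measurable_const hv2 MemLp.zero' hw hk hkc] with z hz
      rw [hz]; simp [mollX]
    have h3 : ∫ x, (∫ y, uin y * deriv k (x - y)) ^ 2 = 0 := by
      rw [h2] at h1
      simp only [mollX, mul_zero, zero_mul, integral_zero, add_zero] at h1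
      exact (mul_eq_zero.1 h1.symm).resolve_left hT.ne'
    have hcd : Continuous fun x => ∫ y, uin y * deriv k (x - y) :=
      hkc.deriv.continuous_convolution_right (ContinuousLinearMap.mul ℝ ℝ) hloc hkd.continuous
    have h4 : (fun x => ∫ y, uin y * deriv k (x - y)) = 0 := by
      rw [integral_eq_zero_iff_of_nonneg (fun x => sq_nonneg _)
        (memLp_convolution hu hu2 hkd.continuous hkc.deriv).integrable_sq] at h3
      refine hcd.ae_eq_iff_eq volume continuous_zero |>.1 ?_
      filter_upwards [h3] with x hx
      simpa using hx
    have hder : ∀ x, HasDerivAt (fun x => ∫ y, uin y * k (x - y)) 0 x := fun x => by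
      have := hkc.hasDerivAt_convolution_right (ContinuousLinearMap.mul ℝ ℝ) hloc
        (hk.of_le (by simp)) x
      rwa [show convolution uin (deriv k) (ContinuousLinearMap.mul ℝ ℝ) volume x = 0 from
        congrFun h4 x] at this
    have hconst : ∀ x, ∫ y, uin y * k (x - y) = ∫ y, uin y * k (0 - y) := fun x =>
      is_const_of_deriv_eq_zero (fun x => (hder x).differentiableAt) (fun x => (hder x).deriv) x 0
    -- The convolution with `k` is now constant in `x`, and a constant in `L²(ℝ)` is zero.
    have hmem := memLp_convolution hu hu2 hk.continuous hkc
    have hmem' : MemLp (fun _ : ℝ => ∫ y, uin y * k (0 - y)) 2 volume := by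
      simpa only [hconst] using hmem
    rw [memLp_const_iff (by norm_num) (by norm_num)] at hmem'
    intro x
    rw [hconst]
    simpa using hmem'
  refine ae_eq_zero_of_integral_contDiff_smul_eq_zero hloc fun k hk hkc => ?_
  have := key (fun y => k (-y)) (hk.comp contDiff_neg) (hkc.comp_homeomorph (Homeomorph.neg ℝ)) 0
  simpa [mul_comm] using this

/-- Heat equations with two different conductivities share a solution only for a zero datum. -/
theorem ae_eq_zero_of_heat_solutions_eq (hT : 0 < T) {uin : ℝ → ℝ} (hu : MemLp uin 2 volume)
    {v v' : ℝ × ℝ → ℝ} (h : IsWeakSolution T 0 (fun _ => 1) uin v)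
    (h' : IsWeakSolution T 0 (fun _ => 2) uin v') (hvv : v =ᵐ[stripMeasure T] v') :
    uin =ᵐ[volume] 0 := by
  obtain ⟨hv, g, hg, hw, hs⟩ := isWeakSolution_zero_iff.1 h
  obtain ⟨-, g', hg', hw', hs'⟩ := isWeakSolution_zero_iff.1 h'
  replace hw' := hw'.congr hvv.symm ae_eq_rfl
  replace hs' := hs'.congr ae_eq_rfl hvv.symm ae_eq_rfl
  have i1 : Integrable (fun z => g z * g z) (stripMeasure T) := hg.integrable_mul hg
  have i2 : Integrable (fun z => g z * g' z) (stripMeasure T) := hg.integrable_mul hg'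
  have i3 : Integrable (fun z => g' z * g' z) (stripMeasure T) := hg'.integrable_mul hg'
  -- The common solution has weak derivatives `g`, `g'` and fluxes `g`, `2g'`, and also every affine
  -- combination of either pair, with independent parameters `m` and `l`. An affine function bounded
  -- above has zero slope; with `p = ∫ g²` and `q = ∫ g g'`, the cases `l = 0` and `m = 0` give `q =
  -- p` and `2q = p`, so `g = 0`.
  have key : ∀ l m : ℝ, 2 * ((1 - l) * (1 - m) * ∫ z, g z * g z ∂stripMeasure T
      + ((1 - l) * m + 2 * l * (1 - m)) * ∫ z, g z * g' z ∂stripMeasure T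
      + 2 * l * m * ∫ z, g' z * g' z ∂stripMeasure T) ≤ ∫ x, uin x ^ 2 := by
    intro l m
    have hw'' := (hw.lincomb hw' hv hv hg hg' (1 - m) m).congr (v' := v)
      (ae_of_all _ fun z => by ring) ae_eq_rfl
    have hs'' := (hs.lincomb hs' hu hu hv hv (hg.const_mul 1) (hg'.const_mul 2) (1 - l) l).congr
      (uin' := uin) (v' := v) (ae_of_all _ fun z => by ring) (ae_of_all _ fun z => by ring) ae_eq_rfl
    have := (hs''.energy hT hu hv (memLp_lincomb hg hg' _ _)
      (memLp_lincomb (hg.const_mul 1) (hg'.const_mul 2) _ _) hw'').1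
    refine le_of_eq_of_le ?_ this
    congr 1
    rw [← integral_const_mul, ← integral_const_mul, ← integral_const_mul,
      ← integral_add (i1.const_mul _) (i2.const_mul _), ← integral_add
        (f := fun z => (1 - l) * (1 - m) * (g z * g z)
          + ((1 - l) * m + 2 * l * (1 - m)) * (g z * g' z))
        ((i1.const_mul _).add (i2.const_mul _)) (i3.const_mul _)]
    exact integral_congr_ae (ae_of_all _ fun z => by ring)
  generalize hp : ∫ z, g z * g z ∂stripMeasure T = p at key
  generalize ∫ z, g z * g' z ∂stripMeasure T = q at key
  generalize ∫ z, g' z * g' z ∂stripMeasure T = r at key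
  have e1 : 2 * (q - p) = 0 := eq_zero_of_forall_add_mul_le (p := 2 * p) (E := ∫ x, uin x ^ 2)
    fun m => by linarith [key 0 m]
  have e2 : 2 * (2 * q - p) = 0 := eq_zero_of_forall_add_mul_le (p := 2 * p)
    (E := ∫ x, uin x ^ 2) fun l => by linarith [key l 0]
  have hp0 : ∫ z, g z ^ 2 ∂stripMeasure T = 0 := by
    simp only [sq, hp]; linarith
  have hg0 : g =ᵐ[stripMeasure T] fun _ => 0 := by
    rw [integral_eq_zero_iff_of_nonneg (fun x => sq_nonneg _) hg.integrable_sq] at hp0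
    filter_upwards [hp0] with z hz
    simpa using hz
  exact ae_eq_zero_of_isWeakFluxSolution_zero hT hu hv (hw.congr ae_eq_rfl hg0)
    (hs.congr ae_eq_rfl ae_eq_rfl (by filter_upwards [hg0] with z hz; rw [hz, mul_zero]))

end Distinct

/-! ### The choice of speeds and the conclusion. -/

/-- If the coefficient equals `c` on the annuli `κ n`, then a point moving at the matching speeds
eventually sees the coefficient `c`. -/
lemma eventually_diffusionCoeff_eq (hT : 0 < T) {κ : ℕ → ℕ} (hκ : Tendsto κ atTop atTop) {c : ℝ}
    (hD : ∀ n x, |x| ∈ Ico ((2 : ℝ) ^ (κ n ^ 2)) ((2 : ℝ) ^ ((κ n + 1) ^ 2)) →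
      diffusionCoeff x = c) (z : ℝ × ℝ) (hz : z.1 ∈ Ioo 0 T) :
    ∀ᶠ n in atTop, diffusionCoeff (z.2 + z.1 / (2 * T / 2 ^ ((κ n + 1) ^ 2))) = c := by
  -- The displacement is `s` times the outer radius, with `s = t/(2T)`; the constant `2T` keeps `s`
  -- inside `(0, 1)`.
  have h1 : z.1 / (2 * T) < 1 := by rw [div_lt_one (by linarith)]; linarith [hz.2]
  have h0 : 0 < z.1 / (2 * T) := div_pos hz.1 (by linarith)
  filter_upwards [hκ.eventually (eventually_mem_annulus h0 h1 z.2)] with n hn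
  refine hD n _ ?_
  rwa [div_div_eq_mul_div, mul_div_right_comm]

end LagrangianLimit

theorem mainTheorem8 (T : ℝ) (hT : 0 < T) :
    ∃ ε ε' : ℕ → ℝ,
      (∀ n, 0 < ε n) ∧ (∀ n, 0 < ε' n) ∧ Tendsto ε atTop (𝓝 0) ∧ Tendsto ε' atTop (𝓝 0) ∧
      ∀ uin : ℝ → ℝ, MemLp uin 2 volume →
      ∀ u : ℝ → ℝ × ℝ → ℝ,
        (∀ e : ℝ, 0 < e →
          LagrangianLimit.IsWeakSolution T (1 / e) LagrangianLimit.diffusionCoeff uin (u e)) →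
        ∃ u₀ u₀' : ℝ × ℝ → ℝ,
          LagrangianLimit.WeaklyConvergesL2 T
            (fun n => LagrangianLimit.lagrangian (ε n) (u (ε n))) u₀ ∧
          LagrangianLimit.WeaklyConvergesL2 T
            (fun n => LagrangianLimit.lagrangian (ε' n) (u (ε' n))) u₀' ∧
          LagrangianLimit.IsWeakSolution T 0 (fun _ => 1) uin u₀ ∧
          LagrangianLimit.IsWeakSolution T 0 (fun _ => 2) uin u₀' ∧
          (¬ uin =ᵐ[volume] 0 → ¬ u₀ =ᵐ[LagrangianLimit.stripMeasure T] u₀') := by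
  have hκ : Tendsto (fun n : ℕ => 2 * n) atTop atTop :=
    tendsto_atTop_mono (fun n => by simp only [id_eq]; omega) tendsto_id
  have hκ' : Tendsto (fun n : ℕ => 2 * n + 1) atTop atTop :=
    tendsto_atTop_mono (fun n => by simp only [id_eq]; omega) tendsto_id
  have hpos : ∀ k : ℕ, 0 < 2 * T / 2 ^ ((k + 1) ^ 2) := fun k => by positivity
  have hlim : Tendsto (fun k : ℕ => 2 * T / 2 ^ ((k + 1) ^ 2)) atTop (𝓝 0) :=
    LagrangianLimit.tendsto_scale.const_div_atTop (2 * T)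
  -- The exponents belong to the outer radii: annulus `2n`, with coefficient `1`, ends at
  -- `2^((2n+1)²)`, and annulus `2n+1`, with coefficient `2`, ends at `2^((2n+2)²)`.
  refine ⟨fun n => 2 * T / 2 ^ ((2 * n + 1) ^ 2), fun n => 2 * T / 2 ^ ((2 * n + 1 + 1) ^ 2),
    fun n => hpos _, fun n => hpos _, hlim.comp hκ, hlim.comp hκ', fun uin huin u hu => ?_⟩
  obtain ⟨u₀, h1, h2⟩ := LagrangianLimit.exists_lagrangian_limit hT zero_le_one
    (fun n => hpos (2 * n))
    (LagrangianLimit.eventually_diffusionCoeff_eq hT hκ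
      fun n x hx => LagrangianLimit.diffusionCoeff_eq_one hx) huin hu
  obtain ⟨u₀', h1', h2'⟩ := LagrangianLimit.exists_lagrangian_limit hT zero_le_two
    (fun n => hpos (2 * n + 1))
    (LagrangianLimit.eventually_diffusionCoeff_eq hT hκ'
      fun n x hx => LagrangianLimit.diffusionCoeff_eq_two hx) huin hu
  exact ⟨u₀, u₀', h1, h1', h2, h2', fun h0 h =>
    h0 (LagrangianLimit.ae_eq_zero_of_heat_solutions_eq hT huin h2 h2' h)⟩
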